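/- Let $w\ge 2$ be an integer and let $\mu$ be a partition of $w$ with conjugate partition $\mu'$. For $k\ge 1$ write $[k]_q=\frac{q^k-q^{-k}}{q-q^{-1}}=q^{k-1}+q^{k-3}+\cdots+q^{1-k}$. For $h\ge 0$ let $s_\mu[s_h](q,q^{-1})=s_\mu(q^{h},q^{h-2},\dots,q^{-h})$ be the plethysm of the Schur functions $s_\mu$ and $s_h$ in the two variables $q,q^{-1}$ (here $s_\mu(x_0,\dots,x_h)$ is the Schur polynomial, the sum of the weights of the semistandard Young tableaux of shape $\mu$ with entries in $\{0,\dots,h\}$). Let $a_{\mu[h]}^{[k]}$ be the coefficient of $[k]_q$ in its expansion $$s_\mu[s_h](q,q^{-1})=\sum_{k\ge 1}a_{\mu[h]}^{[k]}\,[k]_q ,$$ and let $$A_\mu(z,q)=\sum_{k\ge 1,\;h\ge 0}a_{\mu[h]}^{[k]}\,q^kz^h .$$ Then the power series $A_\mu(z,q)$ and $A_{\mu'}(z,q)$ are expansions of (unique) rational functions in $z$ and $q$, and, as an identity of rational functions, $$A_\mu(z^{-1},q^{-1})=(-1)^w z^2A_{\mu'}(z,q).$$ -/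

import Mathlib

namespace SL2Plethysm

open scoped LaurentPolynomial

noncomputable section

/-! ### Schur polynomials and plethysm -/

/-- Semistandard Young tableaux of shape `μ` over the alphabet `{0, 1, …, n - 1}`. -/
abbrev BoundedSSYT (μ : YoungDiagram) (n : ℕ) : Type :=
  {T : SemistandardYoungTableau μ // ∀ c ∈ μ.cells, T c.1 c.2 < n}

instance (μ : YoungDiagram) (n : ℕ) : Finite (BoundedSSYT μ n) := by
  refine Finite.of_injective
    (fun (T : BoundedSSYT μ n) (c : μ.cells) => (⟨T.1 c.1.1 c.1.2, T.2 c.1 c.2⟩ : Fin n)) ?_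
  intro T T' h
  apply Subtype.ext
  apply SemistandardYoungTableau.ext
  intro i j
  by_cases hc : (i, j) ∈ μ
  · have := congrFun h ⟨(i, j), (YoungDiagram.mem_cells _).mpr hc⟩
    simpa using this
  · rw [T.1.zeros hc, T'.1.zeros hc]

instance (μ : YoungDiagram) (n : ℕ) : Fintype (BoundedSSYT μ n) := Fintype.ofFinite _

/-- The Schur polynomial `s_μ(x_0, …, x_{n-1})`, the sum of `x^{wt(T)}` over the semistandard
tableaux `T` of shape `μ` with entries in `{0, …, n - 1}`. -/
def schur (μ : YoungDiagram) (n : ℕ) : MvPolynomial (Fin n) ℤ :=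
  ∑ T : BoundedSSYT μ n,
    ∏ c : μ.cells, MvPolynomial.X ⟨T.1 c.1.1 c.1.2, T.2 c.1 c.2⟩

/-- The plethysm `s_μ[s_h](x, y)` in two variables: the Schur polynomial `s_μ` in `h + 1` variables
evaluated at the `h + 1` monomials `x^h, x^{h-1} y, …, y^h` whose sum is `s_h(x, y)`. -/
def plethysm (μ : YoungDiagram) (h : ℕ) : MvPolynomial (Fin 2) ℤ :=
  MvPolynomial.aeval
    (fun j : Fin (h + 1) =>
      (MvPolynomial.X 0 ^ (h - (j : ℕ)) * MvPolynomial.X 1 ^ (j : ℕ) : MvPolynomial (Fin 2) ℤ))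
    (schur μ (h + 1))

/-- The specialization `s_μ[s_h](q, q⁻¹)`, a Laurent polynomial in `q`. -/
def plethysmSL2 (μ : YoungDiagram) (h : ℕ) : ℤ[T;T⁻¹] :=
  MvPolynomial.aeval ![(LaurentPolynomial.T 1 : ℤ[T;T⁻¹]), LaurentPolynomial.T (-1)]
    (plethysm μ h)

/-! ### Expansion in `q`-integers -/

/-- The `q`-integer `[k]_q = q^{k-1} + q^{k-3} + ⋯ + q^{1-k} = (q^k - q^{-k}) / (q - q⁻¹)`. -/
def qInt (k : ℕ) : ℤ[T;T⁻¹] :=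
  ∑ i ∈ Finset.range k, LaurentPolynomial.T ((k : ℤ) - 1 - 2 * (i : ℤ))

theorem mul_qInt (k : ℕ) :
    (LaurentPolynomial.T 1 - LaurentPolynomial.T (-1) : ℤ[T;T⁻¹]) * qInt k =
      LaurentPolynomial.T (k : ℤ) - LaurentPolynomial.T (-(k : ℤ)) := by
  have h := Finset.sum_range_sub'
    (fun i : ℕ => (LaurentPolynomial.T ((k : ℤ) - 2 * (i : ℤ)) : ℤ[T;T⁻¹])) k
  rw [qInt, Finset.mul_sum]
  have e : (LaurentPolynomial.T (k : ℤ) - LaurentPolynomial.T (-(k : ℤ)) : ℤ[T;T⁻¹]) =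
      LaurentPolynomial.T ((k : ℤ) - 2 * ((0 : ℕ) : ℤ)) -
        LaurentPolynomial.T ((k : ℤ) - 2 * (k : ℤ)) := by
    have e1 : (k : ℤ) - 2 * ((0 : ℕ) : ℤ) = k := by simp
    have e2 : (k : ℤ) - 2 * (k : ℤ) = -(k : ℤ) := by ring
    rw [e1, e2]
  rw [e, ← h]
  refine Finset.sum_congr rfl fun i _ => ?_
  rw [sub_mul, ← LaurentPolynomial.T_add, ← LaurentPolynomial.T_add]
  congr 2
  · ring
  · push_cast; ring

/-- `IsQIntExpansion f a` says that `f = ∑_{k ≥ 1} a_k [k]_q`. -/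
def IsQIntExpansion (f : ℤ[T;T⁻¹]) (a : ℕ →₀ ℤ) : Prop :=
  a 0 = 0 ∧ f = a.sum fun k c => c • qInt k

theorem IsQIntExpansion.unique {f : ℤ[T;T⁻¹]} {a b : ℕ →₀ ℤ}
    (ha : IsQIntExpansion f a) (hb : IsQIntExpansion f b) : a = b := by
  have key : ∀ {c : ℕ →₀ ℤ}, IsQIntExpansion f c → ∀ n : ℕ, 0 < n →
      ((LaurentPolynomial.T 1 - LaurentPolynomial.T (-1) : ℤ[T;T⁻¹]) * f).coeff (n : ℤ) = c n := by
    intro c hc n hn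
    rw [hc.2, Finsupp.sum, Finset.mul_sum]
    simp only [mul_smul_comm, mul_qInt]
    have hz : ∀ i : ℕ, (c i • (LaurentPolynomial.T (i : ℤ) - LaurentPolynomial.T (-(i : ℤ)) :
        ℤ[T;T⁻¹])).coeff (n : ℤ) = if i = n then c n else 0 := by
      intro i
      have h1 : ¬ (-(i : ℤ) = n) := by omega
      rw [AddMonoidAlgebra.coeff_smul_apply, AddMonoidAlgebra.coeff_sub, Finsupp.sub_apply,
        LaurentPolynomial.T_apply, LaurentPolynomial.T_apply, if_neg h1]
      by_cases hi : i = n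
      · subst hi; simp
      · simp [hi]
    rw [AddMonoidAlgebra.coeff_sum, Finsupp.finsetSum_apply, Finset.sum_congr rfl fun i _ => hz i,
      Finset.sum_ite_eq']
    split_ifs with hs
    · rfl
    · exact (Finsupp.notMem_support_iff.mp hs).symm
  ext n
  rcases Nat.eq_zero_or_pos n with rfl | hn
  · rw [ha.1, hb.1]
  · rw [← key ha n hn, ← key hb n hn]

open Classical in
/-- The (unique) family of coefficients `a_k`, `k ≥ 1`, with `f = ∑_{k ≥ 1} a_k [k]_q`. -/
def qIntCoeffs (f : ℤ[T;T⁻¹]) : ℕ →₀ ℤ :=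
  if h : ∃ a, IsQIntExpansion f a then h.choose else 0

theorem IsQIntExpansion.qIntCoeffs_eq {f : ℤ[T;T⁻¹]} {a : ℕ →₀ ℤ} (h : IsQIntExpansion f a) :
    qIntCoeffs f = a := by
  have h' : ∃ a, IsQIntExpansion f a := ⟨a, h⟩
  rw [qIntCoeffs, dif_pos h']
  exact h'.choose_spec.unique h

/-- The `SL₂`-plethysm coefficient `a_{μ[h]}^{[k]}`: the coefficient of `[k]_q` in the expansion of
`s_μ[s_h](q, q⁻¹)`, with the convention `a_{μ[h]}^{[0]} = 0`. -/
def plethysmCoeff (μ : YoungDiagram) (h k : ℕ) : ℤ :=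
  qIntCoeffs (plethysmSL2 μ h) k

/-! ### The generating function and the rational function it represents

In the polynomials, power series and rational functions below the variable `0` is `z` and the
variable `1` is `q`. -/

/-- The generating function `A_μ(z, q) = ∑_{k ≥ 1, h ≥ 0} a_{μ[h]}^{[k]} q^k z^h`. -/
def genFun (μ : YoungDiagram) : MvPowerSeries (Fin 2) ℚ :=
  fun n => (plethysmCoeff μ (n 0) (n 1) : ℚ)

/-- The field `ℚ(z, q)` of rational functions. -/
abbrev RatFun : Type := FractionRing (MvPolynomial (Fin 2) ℚ)

/-- The rational function `z`. -/
def zVar : RatFun := algebraMap (MvPolynomial (Fin 2) ℚ) RatFun (MvPolynomial.X 0)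

/-- The rational function `q`. -/
def qVar : RatFun := algebraMap (MvPolynomial (Fin 2) ℚ) RatFun (MvPolynomial.X 1)

/-- The power series `F` is the expansion at the origin of the rational function `R`. -/
def IsExpansionOf (F : MvPowerSeries (Fin 2) ℚ) (R : RatFun) : Prop :=
  ∃ P D : MvPolynomial (Fin 2) ℚ, D ≠ 0 ∧
    (D : MvPowerSeries (Fin 2) ℚ) * F = (P : MvPowerSeries (Fin 2) ℚ) ∧
    R = algebraMap _ RatFun P / algebraMap _ RatFun D

/-- A power series is the expansion of at most one rational function. -/
theorem IsExpansionOf.unique {F : MvPowerSeries (Fin 2) ℚ} {R R' : RatFun}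
    (h : IsExpansionOf F R) (h' : IsExpansionOf F R') : R = R' := by
  obtain ⟨P, D, hD, hF, rfl⟩ := h
  obtain ⟨P', D', hD', hF', rfl⟩ := h'
  have e : P * D' = P' * D := by
    apply MvPolynomial.coe_injective (Fin 2) ℚ
    rw [MvPolynomial.coe_mul, MvPolynomial.coe_mul, ← hF, ← hF']
    ring
  have inj := IsFractionRing.injective (MvPolynomial (Fin 2) ℚ) RatFun
  rw [div_eq_div_iff ((map_ne_zero_iff _ inj).mpr hD) ((map_ne_zero_iff _ inj).mpr hD'),
    ← map_mul, ← map_mul, e]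

/-- `p(z, q) ↦ p(z⁻¹, q⁻¹)` on polynomials. -/
def invVarsPoly : MvPolynomial (Fin 2) ℚ →ₐ[ℚ] RatFun :=
  MvPolynomial.aeval ![zVar⁻¹, qVar⁻¹]

theorem invVarsPoly_injective : Function.Injective invVarsPoly := by
  set x : Fin 2 → RatFun := ![zVar⁻¹, qVar⁻¹] with hx
  let S := Algebra.adjoin ℚ (Set.range x)
  have hmem : ∀ i, IsAlgebraic S (x i) := fun i =>
    isAlgebraic_algebraMap (⟨x i, Algebra.subset_adjoin ⟨i, rfl⟩⟩ : S)
  have hvar : ∀ i : Fin 2, IsAlgebraic S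
      (algebraMap (MvPolynomial (Fin 2) ℚ) RatFun (MvPolynomial.X i)) := by
    intro i
    have := (hmem i).inv
    fin_cases i <;> simpa [hx, zVar, qVar] using this
  have hpoly : ∀ p : MvPolynomial (Fin 2) ℚ,
      IsAlgebraic S (algebraMap (MvPolynomial (Fin 2) ℚ) RatFun p) := by
    intro p
    induction p using MvPolynomial.induction_on with
    | C a =>
      have : algebraMap (MvPolynomial (Fin 2) ℚ) RatFun (MvPolynomial.C a) =
          algebraMap S RatFun (algebraMap ℚ S a) := by
        rw [← IsScalarTower.algebraMap_apply, ← MvPolynomial.algebraMap_eq,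
          ← IsScalarTower.algebraMap_apply]
      rw [this]
      exact isAlgebraic_algebraMap _
    | add p r hp hr => rw [map_add]; exact hp.add hr
    | mul_X p i hp => rw [map_mul]; exact hp.mul (hvar i)
  have halg : Algebra.IsAlgebraic S RatFun := by
    constructor
    intro r
    obtain ⟨p, d, -, rfl⟩ := IsFractionRing.div_surjective (A := MvPolynomial (Fin 2) ℚ) r
    rw [div_eq_mul_inv]
    exact (hpoly p).mul (hpoly d).inv
  have hind : AlgebraicIndependent ℚ
      (fun i : Fin 2 => algebraMap (MvPolynomial (Fin 2) ℚ) RatFun (MvPolynomial.X i)) :=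
    (MvPolynomial.algebraicIndependent_X (Fin 2) ℚ).map'
      (f := IsScalarTower.toAlgHom ℚ (MvPolynomial (Fin 2) ℚ) RatFun)
      (IsFractionRing.injective _ _)
  exact (Algebra.IsAlgebraic.isTranscendenceBasis_of_le_trdeg_of_finite ℚ x hind.cardinalMk_le_trdeg).1

/-- The substitution `R(z, q) ↦ R(z⁻¹, q⁻¹)` on rational functions. -/
def invVars : RatFun →+* RatFun :=
  IsFractionRing.lift (A := MvPolynomial (Fin 2) ℚ) (g := invVarsPoly.toRingHom)
    invVarsPoly_injective

theorem invVars_zVar : invVars zVar = zVar⁻¹ := by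
  simp [invVars, zVar, invVarsPoly]

theorem invVars_qVar : invVars qVar = qVar⁻¹ := by
  simp [invVars, qVar, invVarsPoly]

end

end SL2Plethysm

/-!
Write `F_μ(z, q) = ∑_h s_μ[s_h](q, q⁻¹) z ^ h` and `w = |μ|`. Because `(q - q⁻¹) [k]_q =
q ^ k - q ^ (-k)` and `s_μ[s_h](q, q⁻¹)` is invariant under `q ↦ q⁻¹`, the series `A_μ` is the part of `G_μ
= (q - q⁻¹) F_μ` with positive powers of `q` (`mul_schurSum_eq`, `antiSeries`). The theorem
follows from a reciprocity for `G_μ` and the fact that taking the positive part commutes with `(z,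
q) ↦ (z⁻¹, q⁻¹)` for rational functions that vanish at `q = ∞`.

*Reciprocity for `F_μ`.* A semistandard tableau is a chain of horizontal strips, so `F_μ` is an
entry of a geometric series in the matrix `H` of horizontal strips, indexed by the diagrams
contained in `μ` (`schurSum_eq_prod`). In other words `z ^ 2 F_μ` is the entry at `∅` of the
solution of `φ = U (e_μ + H φ)`, where `U` is the diagonal matrix with entries `z q ^ (2|ρ| - w)`
(`isStripSolution_stripSeq`). This triangular system has a unique solution, which is a rational
function with denominator `∏ (1 - z q ^ (2 j - w))`, `0 ≤ j ≤ w` (`exists_stripNumerator`).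
Inverting `z` and `q` inverts `U`; since the matrix `V` of vertical strips is, up to signs, the
inverse of `H` (`sum_neg_one_pow_horizontal_vertical`), this turns the system of `μ` into that of
the transposed diagram (`reciprocity_bot`). Invariance under `q ↦ q⁻¹` is an instance of the
symmetry of Schur polynomials, that is of the commutation of the matrices `H(x)`, proved by the
Bender–Knuth involution (`stripMatrix_commute`).

*Positive part.* For `m, n > 0` the factors `1 - z q ^ m` and `q ^ n - z` are coprime over `ℚ(z)`,
so `G_μ = P / ∏ (1 - z q ^ m) + Q / ∏ (q ^ m - z)` up to a factor depending on `z` only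
(`exists_partialFraction`). The first term expands in nonnegative and the second in nonpositive
powers of `q`, hence the first one is `A_μ` (`mul_posSeries_eq`). Both denominators are invariant
under `(z, q) ↦ (z⁻¹, q⁻¹)` up to the same monomial. The numerator of `G_μ` has small enough
degree in `q`, which uses `1 < w` (`exists_weylNumerator`), for `P` and `Q` to be proper; the
inverted decomposition is therefore again one of this shape, now for `G_{μ'}`, and its first term
is `A_{μ'}`.
-/

namespace SL2Plethysm

open scoped LaurentPolynomial Polynomial

/-! ### Horizontal and vertical strips -/

/-- `κ / ν` is a horizontal strip: `ν ⊆ κ` and no column of `κ` has two cells outside `ν`. The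
second condition is phrased as: the cell above any cell of `κ` lies in `ν`. -/
def IsHorizontalStrip (ν κ : YoungDiagram) : Prop :=
  ν ≤ κ ∧ ∀ i j, (i + 1, j) ∈ κ → (i, j) ∈ ν

/-- `κ / ν` is a vertical strip: `ν ⊆ κ` and no row of `κ` has two cells outside `ν`. -/
def IsVerticalStrip (ν κ : YoungDiagram) : Prop :=
  ν ≤ κ ∧ ∀ i j, (i, j + 1) ∈ κ → (i, j) ∈ ν

theorem isHorizontalStrip_transpose {ν κ : YoungDiagram} :
    IsHorizontalStrip ν.transpose κ.transpose ↔ IsVerticalStrip ν κ := by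
  simp only [IsHorizontalStrip, IsVerticalStrip, YoungDiagram.transpose_le_iff,
    YoungDiagram.mem_transpose, Prod.swap_prod_mk]
  exact ⟨fun h => ⟨h.1, fun i j => h.2 j i⟩, fun h => ⟨h.1, fun i j => h.2 j i⟩⟩

theorem IsHorizontalStrip.refl (ν : YoungDiagram) : IsHorizontalStrip ν ν :=
  ⟨le_rfl, fun i _ h => ν.up_left_mem (Nat.le_succ i) le_rfl h⟩

theorem IsVerticalStrip.refl (ν : YoungDiagram) : IsVerticalStrip ν ν :=
  ⟨le_rfl, fun _ j h => ν.up_left_mem le_rfl (Nat.le_succ j) h⟩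

theorem card_mono {ν κ : YoungDiagram} (h : ν ≤ κ) : ν.card ≤ κ.card :=
  Finset.card_le_card (YoungDiagram.cells_subset_iff.mpr h)

theorem card_lt_card_of_le_of_ne {ν κ : YoungDiagram} (h : ν ≤ κ) (hne : ν ≠ κ) :
    ν.card < κ.card :=
  Finset.card_lt_card (YoungDiagram.cells_ssubset_iff.mpr (lt_of_le_of_ne h hne))

theorem card_transpose (μ : YoungDiagram) : μ.transpose.card = μ.card := by
  simp [YoungDiagram.card, YoungDiagram.transpose]

/-- The Young diagrams contained in `μ`. -/
abbrev SubDiagram (μ : YoungDiagram) : Type := {ν : YoungDiagram // ν ≤ μ}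

instance (μ : YoungDiagram) : Finite (SubDiagram μ) := by
  refine Finite.of_injective
    (fun ν : SubDiagram μ => (⟨ν.1.cells, Finset.mem_powerset.mpr ν.2⟩ : μ.cells.powerset)) ?_
  intro ν κ h
  exact Subtype.ext (YoungDiagram.ext (congrArg Subtype.val h))

noncomputable instance (μ : YoungDiagram) : Fintype (SubDiagram μ) := Fintype.ofFinite _

noncomputable instance (μ : YoungDiagram) : DecidableEq (SubDiagram μ) := Classical.decEq _

/-- The diagram `μ` as a subdiagram of itself. -/
def SubDiagram.top (μ : YoungDiagram) : SubDiagram μ := ⟨μ, le_rfl⟩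

/-- The empty diagram as a subdiagram of `μ`. -/
def SubDiagram.bot (μ : YoungDiagram) : SubDiagram μ := ⟨⊥, bot_le⟩

/-! ### Inverting the matrix of horizontal strips -/

/-- Adjoin the cell `c` to `ν` if this gives a Young diagram containing it, remove it if it is
already there; `ν` itself if the result is not a Young diagram. -/
noncomputable def toggle (c : ℕ × ℕ) (ν : YoungDiagram) : YoungDiagram :=
  open Classical in
  if h : IsLowerSet ((symmDiff ν.cells {c} : Finset (ℕ × ℕ)) : Set (ℕ × ℕ)) then ⟨_, h⟩ else ν

theorem toggle_cells {c : ℕ × ℕ} {ν : YoungDiagram}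
    (h : IsLowerSet ((symmDiff ν.cells {c} : Finset (ℕ × ℕ)) : Set (ℕ × ℕ))) :
    (toggle c ν).cells = symmDiff ν.cells {c} := by
  rw [toggle, dif_pos h]

theorem mem_toggle {c d : ℕ × ℕ} {ν : YoungDiagram}
    (h : IsLowerSet ((symmDiff ν.cells {c} : Finset (ℕ × ℕ)) : Set (ℕ × ℕ))) :
    d ∈ toggle c ν ↔ (d ∈ ν ∧ d ≠ c) ∨ (d = c ∧ c ∉ ν) := by
  rw [← YoungDiagram.mem_cells, toggle_cells h, Finset.mem_symmDiff]
  simp only [YoungDiagram.mem_cells, Finset.mem_singleton]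
  by_cases hd : d = c
  · subst hd; tauto
  · tauto

theorem toggle_toggle {c : ℕ × ℕ} {ν : YoungDiagram}
    (h : IsLowerSet ((symmDiff ν.cells {c} : Finset (ℕ × ℕ)) : Set (ℕ × ℕ))) :
    toggle c (toggle c ν) = ν := by
  have e : symmDiff (toggle c ν).cells {c} = ν.cells := by
    rw [toggle_cells h, symmDiff_symmDiff_cancel_right]
  have h' : IsLowerSet ((symmDiff (toggle c ν).cells {c} : Finset (ℕ × ℕ)) : Set (ℕ × ℕ)) := by
    rw [e]; exact ν.isLowerSet
  exact YoungDiagram.ext ((toggle_cells h').trans e)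

theorem neg_one_pow_card_toggle {c : ℕ × ℕ} {ν : YoungDiagram} {R : Type*} [CommRing R]
    (h : IsLowerSet ((symmDiff ν.cells {c} : Finset (ℕ × ℕ)) : Set (ℕ × ℕ))) :
    (-1 : R) ^ ν.card + (-1) ^ (toggle c ν).card = 0 := by
  rw [YoungDiagram.card, YoungDiagram.card, toggle_cells h]
  by_cases hc : c ∈ ν.cells
  · have e : symmDiff ν.cells {c} = ν.cells.erase c := by
      ext d; by_cases hd : d = c <;> simp_all [Finset.mem_symmDiff]
    rw [e, ← Finset.card_erase_add_one hc]
    ring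
  · have e : symmDiff ν.cells {c} = insert c ν.cells := by
      ext d; by_cases hd : d = c <;> simp_all [Finset.mem_symmDiff]
    rw [e, Finset.card_insert_of_notMem hc]
    ring

/-- If `ρ ⊊ κ`, the first row in which they differ ends, in `κ`, in a cell that can be toggled in
any diagram between them. -/
theorem exists_free_cell {ρ κ : YoungDiagram} (h : ρ ≤ κ) (hne : ρ ≠ κ) :
    ∃ i j, (i, j) ∈ κ ∧ (i, j) ∉ ρ ∧ (i, j + 1) ∉ κ ∧
      ∀ i' < i, ∀ j', (i', j') ∈ κ → (i', j') ∈ ρ := by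
  classical
  have hex : ∃ i j, (i, j) ∈ κ ∧ (i, j) ∉ ρ := by
    by_contra! hcon
    exact hne (le_antisymm h fun c hc => hcon c.1 c.2 hc)
  obtain ⟨j, hj, hj'⟩ := Nat.find_spec hex
  set i := Nat.find hex
  have hlt := YoungDiagram.mem_iff_lt_rowLen.mp hj
  refine ⟨i, κ.rowLen i - 1, ?_, ?_, ?_, ?_⟩
  · rw [YoungDiagram.mem_iff_lt_rowLen]; omega
  · intro hmem
    exact hj' (ρ.up_left_mem le_rfl (by omega) hmem)
  · rw [YoungDiagram.mem_iff_lt_rowLen]; omega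
  · intro i' hi' j' hmem
    have := Nat.find_min hex hi'
    push Not at this
    exact this j' hmem

theorem toggle_between {ρ κ ν : YoungDiagram} {i j : ℕ} (h1 : (i, j) ∈ κ) (h2 : (i, j) ∉ ρ)
    (h3 : (i, j + 1) ∉ κ) (h4 : ∀ i' < i, ∀ j', (i', j') ∈ κ → (i', j') ∈ ρ)
    (hρν : IsHorizontalStrip ρ ν) (hνκ : IsVerticalStrip ν κ) :
    IsLowerSet ((symmDiff ν.cells {(i, j)} : Finset (ℕ × ℕ)) : Set (ℕ × ℕ)) ∧
      IsHorizontalStrip ρ (toggle (i, j) ν) ∧ IsVerticalStrip (toggle (i, j) ν) κ := by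
  have hlow : IsLowerSet ((symmDiff ν.cells {(i, j)} : Finset (ℕ × ℕ)) : Set (ℕ × ℕ)) := by
    rintro ⟨a, b⟩ ⟨a', b'⟩ hle hab
    obtain ⟨hle1, hle2⟩ := Prod.mk_le_mk.mp hle
    simp only [Finset.coe_symmDiff, Set.mem_symmDiff, Finset.mem_coe, YoungDiagram.mem_cells,
      Finset.coe_singleton, Set.mem_singleton_iff] at hab ⊢
    by_cases hc : (i, j) ∈ ν
    · rcases hab with ⟨hab, hn⟩ | ⟨e, hn⟩
      · refine Or.inl ⟨ν.up_left_mem hle1 hle2 hab, ?_⟩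
        rintro ⟨rfl, rfl⟩
        -- A cell of `ν` right of or below `(i, j)` would leave `κ`, or force `(i, j) ∈ ρ`.
        rcases Nat.lt_or_ge i a with hlt | hge
        · exact h2 (hρν.2 _ _ (ν.up_left_mem (Nat.succ_le_of_lt hlt) hle2 hab))
        · obtain rfl := le_antisymm hge hle1
          rcases Nat.lt_or_ge j b with hlt | hge'
          · exact h3 (hνκ.1 (ν.up_left_mem le_rfl (Nat.succ_le_of_lt hlt) hab))
          · exact hn (by rw [le_antisymm hge' hle2])
      · exact absurd (e ▸ hc) hn
    · have key : (a, b) = (i, j) → (a', b') ≠ (i, j) → (a', b') ∈ ν := by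
        rintro hab hne
        obtain ⟨rfl, rfl⟩ := Prod.mk.inj hab
        rcases Nat.lt_or_ge a' a with hlt | hge
        · exact hρν.1 (h4 _ hlt _ (κ.up_left_mem hle1 hle2 h1))
        · have ha : a' = a := le_antisymm hle1 hge
          subst ha
          have hlt : b' < b := lt_of_le_of_ne hle2 (fun e => hne (by rw [e]))
          exact hνκ.2 _ _ (κ.up_left_mem le_rfl (Nat.succ_le_of_lt hlt) h1)
      by_cases hne : (a', b') = (i, j)
      · exact Or.inr ⟨hne, by rw [hne]; exact hc⟩
      · rcases hab with ⟨hab, hn⟩ | ⟨hab, hn⟩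
        · exact Or.inl ⟨ν.up_left_mem hle1 hle2 hab, hne⟩
        · exact Or.inl ⟨key hab hne, hne⟩
  refine ⟨hlow, ⟨?_, ?_⟩, ⟨?_, ?_⟩⟩
  · intro d hd
    rw [mem_toggle hlow]
    exact Or.inl ⟨hρν.1 hd, fun e => h2 (e ▸ hd)⟩
  · intro a b hab
    rcases (mem_toggle hlow).mp hab with ⟨hab, -⟩ | ⟨hab, -⟩
    · exact hρν.2 a b hab
    · obtain ⟨rfl, rfl⟩ := Prod.mk.inj hab
      exact h4 a (Nat.lt_succ_self a) b (κ.up_left_mem (Nat.le_succ a) le_rfl h1)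
  · intro d hd
    rcases (mem_toggle hlow).mp hd with ⟨hd, -⟩ | ⟨rfl, -⟩
    · exact hνκ.1 hd
    · exact h1
  · intro a b hab
    rw [mem_toggle hlow]
    refine Or.inl ⟨hνκ.2 a b hab, ?_⟩
    intro e
    obtain ⟨rfl, rfl⟩ := Prod.mk.inj e
    exact h3 hab

open Classical in
/-- The signed form of `(∑ h_k) (∑ (-1)^k e_k) = 1`, read on the Young lattice. -/
theorem sum_neg_one_pow_horizontal_vertical {μ : YoungDiagram} {R : Type*} [CommRing R]
    (ρ κ : SubDiagram μ) :
    ∑ ν : SubDiagram μ, (if IsHorizontalStrip ρ.1 ν.1 then (1 : R) else 0) * (-1) ^ ν.1.card *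
      (if IsVerticalStrip ν.1 κ.1 then 1 else 0) = if ρ = κ then (-1) ^ ρ.1.card else 0 := by
  have hsum : ∀ s : Finset (SubDiagram μ),
      (∀ ν : SubDiagram μ, ν ∈ s ↔ IsHorizontalStrip ρ.1 ν.1 ∧ IsVerticalStrip ν.1 κ.1) →
      ∑ ν : SubDiagram μ, (if IsHorizontalStrip ρ.1 ν.1 then (1 : R) else 0) * (-1) ^ ν.1.card *
        (if IsVerticalStrip ν.1 κ.1 then 1 else 0) = ∑ ν ∈ s, (-1) ^ ν.1.card := by
    intro s hs
    rw [← Finset.sum_subset (Finset.subset_univ s)]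
    · refine Finset.sum_congr rfl fun ν hν => ?_
      obtain ⟨h1, h2⟩ := (hs ν).mp hν
      simp [h1, h2]
    · intro ν _ hν
      rw [hs, not_and_or] at hν
      rcases hν with h | h <;> simp [h]
  split_ifs with hρκ
  · subst hρκ
    rw [hsum {ρ}, Finset.sum_singleton]
    intro ν
    rw [Finset.mem_singleton]
    constructor
    · rintro rfl; exact ⟨.refl _, .refl _⟩
    · rintro ⟨h1, h2⟩; exact Subtype.ext (le_antisymm h2.1 h1.1)
  rw [hsum (Finset.univ.filter fun ν : SubDiagram μ =>
    IsHorizontalStrip ρ.1 ν.1 ∧ IsVerticalStrip ν.1 κ.1) (by simp)]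
  by_cases hle : ρ.1 ≤ κ.1
  · obtain ⟨i, j, h1, h2, h3, h4⟩ := exists_free_cell hle (fun e => hρκ (Subtype.ext e))
    refine Finset.sum_involution (g := fun ν hν => ⟨toggle (i, j) ν.1, ?_⟩) ?_ ?_ ?_ ?_
    · rw [Finset.mem_filter] at hν
      exact (toggle_between h1 h2 h3 h4 hν.2.1 hν.2.2).2.2.1.trans κ.2
    · intro ν hν
      rw [Finset.mem_filter] at hν
      exact neg_one_pow_card_toggle (toggle_between h1 h2 h3 h4 hν.2.1 hν.2.2).1
    · intro ν hν _ e
      rw [Finset.mem_filter] at hν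
      have hl := (toggle_between h1 h2 h3 h4 hν.2.1 hν.2.2).1
      have e1 : toggle (i, j) ν.1 = ν.1 := congrArg Subtype.val e
      have := mem_toggle (d := (i, j)) hl
      rw [e1] at this
      tauto
    · intro ν hν
      rw [Finset.mem_filter] at hν ⊢
      exact ⟨Finset.mem_univ _, (toggle_between h1 h2 h3 h4 hν.2.1 hν.2.2).2⟩
    · intro ν hν
      rw [Finset.mem_filter] at hν
      exact Subtype.ext (toggle_toggle (toggle_between h1 h2 h3 h4 hν.2.1 hν.2.2).1)
  · rw [Finset.filter_false_of_mem, Finset.sum_empty]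
    rintro ν - ⟨ha, hb⟩
    exact hle (ha.1.trans hb.1)

/-! ### Commuting horizontal strips -/

theorem le_iff_rowLen_le {ν κ : YoungDiagram} : ν ≤ κ ↔ ∀ i, ν.rowLen i ≤ κ.rowLen i := by
  constructor
  · intro h i
    by_contra! hlt
    have := h (YoungDiagram.mem_iff_lt_rowLen.mpr hlt)
    exact lt_irrefl _ (YoungDiagram.mem_iff_lt_rowLen.mp this)
  · rintro h ⟨i, j⟩ hc
    exact YoungDiagram.mem_iff_lt_rowLen.mpr ((YoungDiagram.mem_iff_lt_rowLen.mp hc).trans_le (h i))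

theorem ext_rowLen {ν κ : YoungDiagram} (h : ∀ i, ν.rowLen i = κ.rowLen i) : ν = κ :=
  le_antisymm (le_iff_rowLen_le.mpr fun i => (h i).le) (le_iff_rowLen_le.mpr fun i => (h i).ge)

theorem isHorizontalStrip_iff_rowLen {ν κ : YoungDiagram} :
    IsHorizontalStrip ν κ ↔ ∀ i, ν.rowLen i ≤ κ.rowLen i ∧ κ.rowLen (i + 1) ≤ ν.rowLen i := by
  rw [IsHorizontalStrip, le_iff_rowLen_le, forall_and]
  refine and_congr_right fun _ => forall_congr' fun i => ?_
  simp only [YoungDiagram.mem_iff_lt_rowLen]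
  constructor
  · intro h
    by_contra! hlt
    exact lt_irrefl _ (h _ hlt)
  · intro h j hj
    exact hj.trans_le h

theorem card_eq_sum_rowLen {ν : YoungDiagram} {n : ℕ} (hn : ν.rowLen n = 0) :
    ν.card = ∑ i ∈ Finset.range n, ν.rowLen i := by
  rw [YoungDiagram.card, Finset.card_eq_sum_card_fiberwise (f := Prod.fst) (t := Finset.range n)]
  · exact Finset.sum_congr rfl fun i _ => (ν.rowLen_eq_card).symm
  · rintro ⟨i, j⟩ hc
    rw [Finset.mem_coe, Finset.mem_range]
    by_contra! hle
    have h1 := YoungDiagram.mem_iff_lt_rowLen.mp (YoungDiagram.mem_cells _ |>.mp hc)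
    have h2 := ν.rowLen_anti n i hle
    omega

theorem rowLen_card (κ : YoungDiagram) : κ.rowLen κ.card = 0 := by
  by_contra hne
  have h1 : (κ.card, 0) ∈ κ := YoungDiagram.mem_iff_lt_rowLen.mpr (Nat.pos_of_ne_zero hne)
  have h2 : κ.card < κ.colLen 0 := YoungDiagram.mem_iff_lt_colLen.mp h1
  have h3 : κ.colLen 0 ≤ κ.card := by
    rw [YoungDiagram.colLen_eq_card]
    exact Finset.card_le_card (Finset.filter_subset _ _)
  omega

/-- The diagram with row lengths `f`, where `f` is weakly decreasing and bounded by the row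
lengths of `κ`. -/
def ofRowLenFun (κ : YoungDiagram) (f : ℕ → ℕ) (hf : Antitone f) : YoungDiagram where
  cells := κ.cells.filter fun c => c.2 < f c.1
  isLowerSet := by
    rintro ⟨a, b⟩ ⟨a', b'⟩ hle hab
    obtain ⟨h1, h2⟩ := Prod.mk_le_mk.mp hle
    simp only [Finset.coe_filter, Set.mem_ofPred_eq, YoungDiagram.mem_cells] at hab ⊢
    exact ⟨κ.up_left_mem h1 h2 hab.1, h2.trans_lt (hab.2.trans_le (hf h1))⟩

theorem rowLen_ofRowLenFun {κ : YoungDiagram} {f : ℕ → ℕ} (hf : Antitone f)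
    (hle : ∀ i, f i ≤ κ.rowLen i) (i : ℕ) : (ofRowLenFun κ f hf).rowLen i = f i := by
  have key : ∀ j, j < (ofRowLenFun κ f hf).rowLen i ↔ j < f i := by
    intro j
    rw [← YoungDiagram.mem_iff_lt_rowLen]
    change (i, j) ∈ κ.cells.filter (fun c => c.2 < f c.1) ↔ j < f i
    rw [Finset.mem_filter, YoungDiagram.mem_cells, YoungDiagram.mem_iff_lt_rowLen]
    exact ⟨fun h => h.2, fun h => ⟨h.trans_le (hle i), h⟩⟩
  have h1 := key (f i)
  have h2 := key ((ofRowLenFun κ f hf).rowLen i)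
  omega

/-- If `ρ ⊆ ν ⊆ κ` are horizontal strips, the `i`-th row length of `ν` ranges independently over
the interval from `max (ρ_i) (κ_{i+1})` to `min (ρ_{i-1}) (κ_i)`; this is its mirror image in that
interval (the upper end being `κ_0` for `i = 0`). -/
def mirrorRow (ρ κ ν : YoungDiagram) (i : ℕ) : ℕ :=
  max (ρ.rowLen i) (κ.rowLen (i + 1)) +
    (if i = 0 then κ.rowLen 0 else min (ρ.rowLen (i - 1)) (κ.rowLen i)) - ν.rowLen i

theorem mirrorRow_spec {ρ κ ν : YoungDiagram} (h1 : IsHorizontalStrip ρ ν)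
    (h2 : IsHorizontalStrip ν κ) :
    (∀ i, ρ.rowLen i ≤ mirrorRow ρ κ ν i ∧ mirrorRow ρ κ ν (i + 1) ≤ ρ.rowLen i) ∧
      (∀ i, mirrorRow ρ κ ν i ≤ κ.rowLen i ∧ κ.rowLen (i + 1) ≤ mirrorRow ρ κ ν i) ∧
      ∀ i, mirrorRow ρ κ ν i + ν.rowLen i = max (ρ.rowLen i) (κ.rowLen (i + 1)) +
        (if i = 0 then κ.rowLen 0 else min (ρ.rowLen (i - 1)) (κ.rowLen i)) := by
  rw [isHorizontalStrip_iff_rowLen] at h1 h2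
  have key : ∀ i, max (ρ.rowLen i) (κ.rowLen (i + 1)) ≤ ν.rowLen i ∧
      ν.rowLen i ≤ (if i = 0 then κ.rowLen 0 else min (ρ.rowLen (i - 1)) (κ.rowLen i)) := by
    intro i
    rcases i with _ | i
    · have := h1 0; have := h2 0; simp only [if_true]; omega
    · have := h1 i; have := h2 i; have := h1 (i + 1); have := h2 (i + 1)
      simp only [Nat.succ_ne_zero, if_false, Nat.add_sub_cancel]; omega
  refine ⟨fun i => ⟨?_, ?_⟩, fun i => ⟨?_, ?_⟩, fun i => ?_⟩
  · have := key i; simp only [mirrorRow]; omega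
  · have := key (i + 1)
    simp only [mirrorRow, Nat.succ_ne_zero, if_false, Nat.add_sub_cancel] at this ⊢; omega
  · have := key i
    rcases i with _ | i
    · simp only [mirrorRow, if_true] at this ⊢; omega
    · simp only [mirrorRow, Nat.succ_ne_zero, if_false, Nat.add_sub_cancel] at this ⊢; omega
  · have := key i; simp only [mirrorRow]; omega
  · have := key i; simp only [mirrorRow]; omega

theorem mirrorRow_antitone {ρ κ ν : YoungDiagram} (h1 : IsHorizontalStrip ρ ν)
    (h2 : IsHorizontalStrip ν κ) : Antitone (mirrorRow ρ κ ν) :=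
  antitone_nat_of_succ_le fun i =>
    ((mirrorRow_spec h1 h2).1 i).2.trans ((mirrorRow_spec h1 h2).1 i).1

open Classical in
/-- The Bender–Knuth involution on the diagrams between `ρ` and `κ`. -/
noncomputable def mirror (ρ κ ν : YoungDiagram) : YoungDiagram :=
  if h : Antitone (mirrorRow ρ κ ν) then ofRowLenFun κ (mirrorRow ρ κ ν) h else ν

theorem rowLen_mirror {ρ κ ν : YoungDiagram} (h1 : IsHorizontalStrip ρ ν)
    (h2 : IsHorizontalStrip ν κ) (i : ℕ) : (mirror ρ κ ν).rowLen i = mirrorRow ρ κ ν i := by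
  rw [mirror, dif_pos (mirrorRow_antitone h1 h2)]
  exact rowLen_ofRowLenFun _ (fun i => ((mirrorRow_spec h1 h2).2.1 i).1) i

theorem isHorizontalStrip_mirror {ρ κ ν : YoungDiagram} (h1 : IsHorizontalStrip ρ ν)
    (h2 : IsHorizontalStrip ν κ) :
    IsHorizontalStrip ρ (mirror ρ κ ν) ∧ IsHorizontalStrip (mirror ρ κ ν) κ := by
  simp only [isHorizontalStrip_iff_rowLen, rowLen_mirror h1 h2]
  exact ⟨(mirrorRow_spec h1 h2).1, (mirrorRow_spec h1 h2).2.1⟩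

theorem mirror_mirror {ρ κ ν : YoungDiagram} (h1 : IsHorizontalStrip ρ ν)
    (h2 : IsHorizontalStrip ν κ) : mirror ρ κ (mirror ρ κ ν) = ν := by
  obtain ⟨h3, h4⟩ := isHorizontalStrip_mirror h1 h2
  refine ext_rowLen fun i => ?_
  rw [rowLen_mirror h3 h4]
  have e1 := (mirrorRow_spec h1 h2).2.2 i
  have e2 := (mirrorRow_spec h3 h4).2.2 i
  rw [rowLen_mirror h1 h2] at e2
  omega

theorem card_mirror {ρ κ ν : YoungDiagram} (h1 : IsHorizontalStrip ρ ν)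
    (h2 : IsHorizontalStrip ν κ) : (mirror ρ κ ν).card + ν.card = ρ.card + κ.card := by
  obtain ⟨h3, h4⟩ := isHorizontalStrip_mirror h1 h2
  obtain ⟨n, hκ⟩ : ∃ n, ∀ m, n ≤ m → κ.rowLen m = 0 := ⟨κ.card, fun m hm =>
    Nat.le_zero.mp ((κ.rowLen_anti _ _ hm).trans (rowLen_card κ).le)⟩
  have hle : ∀ {ξ : YoungDiagram}, ξ ≤ κ → ξ.rowLen (n + 1) = 0 := fun h =>
    Nat.le_zero.mp ((le_iff_rowLen_le.mp h _).trans (hκ _ (Nat.le_succ n)).le)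
  have hle' : ∀ {ξ : YoungDiagram}, ξ ≤ κ → ξ.rowLen n = 0 := fun h =>
    Nat.le_zero.mp ((le_iff_rowLen_le.mp h _).trans (hκ _ le_rfl).le)
  rw [card_eq_sum_rowLen (hle h4.1), card_eq_sum_rowLen (hle h2.1), ← Finset.sum_add_distrib]
  simp only [rowLen_mirror h1 h2, (mirrorRow_spec h1 h2).2.2]
  rw [Finset.sum_add_distrib, Finset.sum_range_succ, Finset.sum_range_succ' (n := n)]
  simp only [Nat.succ_ne_zero, if_false, if_true, Nat.add_sub_cancel]
  rw [card_eq_sum_rowLen (hle' (h3.1.trans h4.1)), card_eq_sum_rowLen (hle le_rfl),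
    Finset.sum_range_succ' (n := n), hle' (h3.1.trans h4.1), hκ (n + 1) (Nat.le_succ n)]
  have : ∑ i ∈ Finset.range n, max (ρ.rowLen i) (κ.rowLen (i + 1)) +
      ∑ i ∈ Finset.range n, min (ρ.rowLen i) (κ.rowLen (i + 1)) =
      ∑ i ∈ Finset.range n, ρ.rowLen i + ∑ i ∈ Finset.range n, κ.rowLen (i + 1) := by
    rw [← Finset.sum_add_distrib, ← Finset.sum_add_distrib]
    exact Finset.sum_congr rfl fun i _ => max_add_min _ _
  simp only [max_self, add_zero]
  omega

open Classical in
/-- The transfer matrix of Schur functions: its `(ρ, ν)` entry is the skew Schur polynomial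
`s_{ν/ρ}(x)` in the single variable `x`, that is `x ^ |ν/ρ|` if `ν / ρ` is a horizontal strip and
`0` otherwise. -/
noncomputable def stripMatrix (μ : YoungDiagram) {R : Type*} [CommRing R] (x : R) :
    Matrix (SubDiagram μ) (SubDiagram μ) R :=
  fun ρ ν => if IsHorizontalStrip ρ.1 ν.1 then x ^ (ν.1.card - ρ.1.card) else 0

/-- The symmetry of Schur polynomials: exchanging the sizes of two consecutive horizontal strips
from `ρ` to `κ` by the Bender–Knuth involution. -/
theorem stripMatrix_commute (μ : YoungDiagram) {R : Type*} [CommRing R] (x y : R) :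
    Commute (stripMatrix μ x) (stripMatrix μ y) := by
  classical
  have hsum : ∀ (x y : R) (ρ κ : SubDiagram μ), (stripMatrix μ x * stripMatrix μ y) ρ κ =
      ∑ ν ∈ Finset.univ.filter (fun ν : SubDiagram μ =>
        IsHorizontalStrip ρ.1 ν.1 ∧ IsHorizontalStrip ν.1 κ.1),
        x ^ (ν.1.card - ρ.1.card) * y ^ (κ.1.card - ν.1.card) := by
    intro x y ρ κ
    rw [Matrix.mul_apply, Finset.sum_filter]
    refine Finset.sum_congr rfl fun ν _ => ?_
    by_cases h1 : IsHorizontalStrip ρ.1 ν.1 <;> by_cases h2 : IsHorizontalStrip ν.1 κ.1 <;>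
      simp [stripMatrix, h1, h2]
  ext ρ κ
  rw [hsum, hsum]
  have hmap : ∀ ν : SubDiagram μ,
      ν ∈ Finset.univ.filter (fun ν : SubDiagram μ =>
        IsHorizontalStrip ρ.1 ν.1 ∧ IsHorizontalStrip ν.1 κ.1) →
      mirror ρ.1 κ.1 ν.1 ≤ μ := fun ν hν =>
    (isHorizontalStrip_mirror (Finset.mem_filter.mp hν).2.1
      (Finset.mem_filter.mp hν).2.2).2.1.trans κ.2
  refine Finset.sum_bij' (fun ν hν => ⟨mirror ρ.1 κ.1 ν.1, hmap ν hν⟩)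
    (fun ν hν => ⟨mirror ρ.1 κ.1 ν.1, hmap ν hν⟩) ?_ ?_ ?_ ?_ ?_
  · intro ν hν
    obtain ⟨-, h1, h2⟩ := Finset.mem_filter.mp hν
    exact Finset.mem_filter.mpr ⟨Finset.mem_univ _, isHorizontalStrip_mirror h1 h2⟩
  · intro ν hν
    obtain ⟨-, h1, h2⟩ := Finset.mem_filter.mp hν
    exact Finset.mem_filter.mpr ⟨Finset.mem_univ _, isHorizontalStrip_mirror h1 h2⟩
  · intro ν hν
    obtain ⟨-, h1, h2⟩ := Finset.mem_filter.mp hν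
    exact Subtype.ext (mirror_mirror h1 h2)
  · intro ν hν
    obtain ⟨-, h1, h2⟩ := Finset.mem_filter.mp hν
    exact Subtype.ext (mirror_mirror h1 h2)
  · intro ν hν
    obtain ⟨-, h1, h2⟩ := Finset.mem_filter.mp hν
    have e := card_mirror h1 h2
    have h3 := card_mono h1.1
    have h4 := card_mono h2.1
    have e1 : κ.1.card - (mirror ρ.1 κ.1 ν.1).card = ν.1.card - ρ.1.card := by omega
    have e2 : (mirror ρ.1 κ.1 ν.1).card - ρ.1.card = κ.1.card - ν.1.card := by omega
    simp only [e1, e2]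
    exact mul_comm _ _

/-! ### Schur polynomials as products of transfer matrices -/

/-- The Schur polynomial `s_ν(x_0, …, x_{n-1})` evaluated in a commutative ring. -/
noncomputable def schurSum (ν : YoungDiagram) (n : ℕ) {R : Type*} [CommRing R] (x : ℕ → R) : R :=
  ∑ T : BoundedSSYT ν n, ∏ c ∈ ν.cells, x (T.1 c.1 c.2)

theorem aeval_schur (ν : YoungDiagram) (n : ℕ) {R : Type*} [CommRing R] [Algebra ℤ R]
    (x : ℕ → R) :
    MvPolynomial.aeval (fun j : Fin n => x j) (schur ν n) = schurSum ν n x := by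
  rw [schur, map_sum, schurSum]
  refine Finset.sum_congr rfl fun T _ => ?_
  rw [map_prod]
  simp only [MvPolynomial.aeval_X]
  exact Finset.prod_coe_sort ν.cells fun c => x (T.1 c.1 c.2)

/-- The cells of a tableau with entry `< n`. -/
def subShape {κ : YoungDiagram} (T : SemistandardYoungTableau κ) (n : ℕ) : YoungDiagram where
  cells := κ.cells.filter fun c => T c.1 c.2 < n
  isLowerSet := by
    rintro ⟨a, b⟩ ⟨a', b'⟩ hle hab
    obtain ⟨h1, h2⟩ := Prod.mk_le_mk.mp hle
    simp only [Finset.coe_filter, Set.mem_ofPred_eq, YoungDiagram.mem_cells] at hab ⊢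
    refine ⟨κ.up_left_mem h1 h2 hab.1, lt_of_le_of_lt ?_ hab.2⟩
    exact (T.row_weak_of_le h2 (κ.up_left_mem h1 le_rfl hab.1)).trans (T.col_weak h1 hab.1)

theorem mem_subShape {κ : YoungDiagram} {T : SemistandardYoungTableau κ} {n : ℕ} {i j : ℕ} :
    (i, j) ∈ subShape T n ↔ (i, j) ∈ κ ∧ T i j < n := by
  change (i, j) ∈ κ.cells.filter (fun c => T c.1 c.2 < n) ↔ _
  simp

/-- Restriction of a tableau to a smaller shape. -/
def restrictTableau {ν κ : YoungDiagram} (h : ν ≤ κ) (T : SemistandardYoungTableau κ) :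
    SemistandardYoungTableau ν where
  entry i j := if (i, j) ∈ ν then T i j else 0
  row_weak' hj hc := by
    rw [if_pos hc, if_pos (ν.up_left_mem le_rfl hj.le hc)]
    exact T.row_weak hj (h hc)
  col_strict' hi hc := by
    rw [if_pos hc, if_pos (ν.up_left_mem hi.le le_rfl hc)]
    exact T.col_strict hi (h hc)
  zeros' hc := if_neg hc

theorem restrictTableau_apply {ν κ : YoungDiagram} (h : ν ≤ κ) (T : SemistandardYoungTableau κ)
    (i j : ℕ) : restrictTableau h T i j = if (i, j) ∈ ν then T i j else 0 := rfl

/-- Extension of a tableau by a horizontal strip filled with the new largest entry `n`. -/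
def extendTableau {ν κ : YoungDiagram} {n : ℕ} (h : IsHorizontalStrip ν κ) (T : BoundedSSYT ν n) :
    SemistandardYoungTableau κ where
  entry i j := if (i, j) ∈ ν then T.1 i j else if (i, j) ∈ κ then n else 0
  row_weak' {i j1 j2} hj hc := by
    by_cases h2 : (i, j2) ∈ ν
    · rw [if_pos h2, if_pos (ν.up_left_mem le_rfl hj.le h2)]
      exact T.1.row_weak hj h2
    · rw [if_neg h2, if_pos hc]
      split_ifs with h1 h3
      · exact (T.2 (i, j1) h1).le
      · exact le_rfl
      · exact Nat.zero_le _
  col_strict' {i1 i2 j} hi hc := by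
    obtain ⟨i, rfl⟩ : ∃ i, i2 = i + 1 := ⟨i2 - 1, by omega⟩
    have h1 : (i1, j) ∈ ν := ν.up_left_mem (by omega) le_rfl (h.2 i j hc)
    rw [if_pos h1]
    split_ifs with h2
    · exact T.1.col_strict hi h2
    · exact T.2 (i1, j) h1
  zeros' hc := by rw [if_neg (fun hν => hc (h.1 hν)), if_neg hc]

theorem extendTableau_apply {ν κ : YoungDiagram} {n : ℕ} (h : IsHorizontalStrip ν κ)
    (T : BoundedSSYT ν n) (i j : ℕ) : extendTableau h T i j =
      if (i, j) ∈ ν then T.1 i j else if (i, j) ∈ κ then n else 0 := rfl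

theorem isHorizontalStrip_subShape {κ : YoungDiagram} {n : ℕ} (T : BoundedSSYT κ (n + 1)) :
    IsHorizontalStrip (subShape T.1 n) κ := by
  refine ⟨fun ⟨i, j⟩ hc => (mem_subShape.mp hc).1, fun i j hc => mem_subShape.mpr
    ⟨κ.up_left_mem (Nat.le_succ i) le_rfl hc, ?_⟩⟩
  have h1 := T.2 _ hc
  have h2 := T.1.col_strict (Nat.lt_succ_self i) hc
  simp only [Nat.succ_eq_add_one] at h1 h2
  omega

open Classical in
/-- Removing the entries `n` from the tableaux with entries `≤ n`. -/
theorem schurSum_succ {μ : YoungDiagram} (κ : SubDiagram μ) (n : ℕ) {R : Type*} [CommRing R]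
    (x : ℕ → R) : schurSum κ.1 (n + 1) x =
      ∑ ν : SubDiagram μ, schurSum ν.1 n x * stripMatrix μ (x n) ν κ := by
  rw [schurSum, ← Finset.sum_fiberwise_of_maps_to (t := Finset.univ)
    (g := fun T : BoundedSSYT κ.1 (n + 1) =>
      (⟨subShape T.1 n, (isHorizontalStrip_subShape T).1.trans κ.2⟩ : SubDiagram μ))
    (fun _ _ => Finset.mem_univ _)]
  refine Finset.sum_congr rfl fun ν _ => ?_
  by_cases h : IsHorizontalStrip ν.1 κ.1
  · rw [stripMatrix, if_pos h, schurSum, Finset.sum_mul]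
    refine Finset.sum_bij' (fun T hT => (⟨restrictTableau h.1 T.1, ?_⟩ : BoundedSSYT ν.1 n))
      (fun T _ => (⟨extendTableau h T, ?_⟩ : BoundedSSYT κ.1 (n + 1))) ?_ ?_ ?_ ?_ ?_
    · intro c hc
      rw [restrictTableau_apply, if_pos (show (c.1, c.2) ∈ ν.1 from hc)]
      have e := congrArg Subtype.val (Finset.mem_filter.mp hT).2
      simp only at e
      rw [YoungDiagram.mem_cells, ← e] at hc
      exact (mem_subShape.mp hc).2
    · intro c hc
      rw [extendTableau_apply]
      split_ifs with h1
      · exact (T.2 c h1).trans (Nat.lt_succ_self n)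
      · exact Nat.lt_succ_self n
      · exact Nat.succ_pos n
    · intro T _
      exact Finset.mem_univ _
    · intro T _
      refine Finset.mem_filter.mpr ⟨Finset.mem_univ _, Subtype.ext (SetLike.ext ?_)⟩
      rintro ⟨i, j⟩
      rw [mem_subShape, extendTableau_apply]
      by_cases h1 : (i, j) ∈ ν.1
      · rw [if_pos h1]
        exact iff_of_true ⟨h.1 h1, T.2 _ h1⟩ h1
      · rw [if_neg h1]
        refine iff_of_false (fun h2 => ?_) h1
        rw [if_pos h2.1] at h2
        exact lt_irrefl _ h2.2
    · intro T hT
      have e : subShape T.1 n = ν.1 := congrArg Subtype.val (Finset.mem_filter.mp hT).2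
      refine Subtype.ext (SemistandardYoungTableau.ext fun i j => ?_)
      rw [extendTableau_apply]
      simp only [restrictTableau_apply]
      split_ifs with h1 h2
      · rfl
      · have h3 := T.2 _ h2
        rw [← e, mem_subShape] at h1
        simp only at h3
        have : ¬ T.1 i j < n := fun h4 => h1 ⟨h2, h4⟩
        omega
      · exact (T.1.zeros h2).symm
    · intro T _
      refine Subtype.ext (SemistandardYoungTableau.ext fun i j => ?_)
      rw [restrictTableau_apply]
      simp only [extendTableau_apply]
      split_ifs with h1
      · rfl
      · exact (T.1.zeros h1).symm
    · intro T hT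
      have e : subShape T.1 n = ν.1 := congrArg Subtype.val (Finset.mem_filter.mp hT).2
      have hsub : ν.1.cells ⊆ κ.1.cells := YoungDiagram.cells_subset_iff.mpr h.1
      rw [← Finset.prod_sdiff hsub, mul_comm]
      congr 1
      · refine Finset.prod_congr rfl fun c hc => ?_
        simp only [restrictTableau_apply]
        rw [if_pos ((YoungDiagram.mem_cells c).mp hc)]
      · rw [YoungDiagram.card, YoungDiagram.card, ← Finset.card_sdiff_of_subset hsub,
          ← Finset.prod_const]
        refine Finset.prod_congr rfl fun c hc => ?_
        obtain ⟨h1, h2⟩ := Finset.mem_sdiff.mp hc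
        have h3 := T.2 c h1
        rw [← e, YoungDiagram.mem_cells, mem_subShape] at h2
        have : ¬ T.1 c.1 c.2 < n := fun h4 => h2 ⟨h1, h4⟩
        congr 1
        omega
  · rw [stripMatrix, if_neg h, mul_zero]
    refine Finset.sum_eq_zero fun T hT => absurd ?_ h
    have e : subShape T.1 n = ν.1 := congrArg Subtype.val (Finset.mem_filter.mp hT).2
    exact e ▸ isHorizontalStrip_subShape T

open Classical in
theorem schurSum_zero {μ : YoungDiagram} (ν : SubDiagram μ) {R : Type*} [CommRing R]
    (x : ℕ → R) : schurSum ν.1 0 x = if SubDiagram.bot μ = ν then 1 else 0 := by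
  split_ifs with h
  · subst h
    have : Unique (BoundedSSYT (SubDiagram.bot μ).1 0) :=
      { default := ⟨SemistandardYoungTableau.highestWeight (SubDiagram.bot μ).1,
          fun c hc => absurd hc (YoungDiagram.notMem_bot c)⟩
        uniq := fun T => Subtype.ext (SemistandardYoungTableau.ext fun i j =>
          (T.1.zeros (YoungDiagram.notMem_bot _)).trans
            (SemistandardYoungTableau.zeros (SemistandardYoungTableau.highestWeight _)
              (YoungDiagram.notMem_bot _)).symm) }
    rw [schurSum, Fintype.sum_unique]
    simp [SubDiagram.bot]
  · have hne : ν.1 ≠ ⊥ := fun e => h (Subtype.ext e.symm)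
    obtain ⟨c, hc⟩ : ν.1.cells.Nonempty := by
      rw [Finset.nonempty_iff_ne_empty]
      exact fun e => hne (YoungDiagram.ext e)
    have : IsEmpty (BoundedSSYT ν.1 0) := ⟨fun T => Nat.not_lt_zero _ (T.2 c hc)⟩
    rw [schurSum, Finset.univ_eq_empty, Finset.sum_empty]

theorem schurSum_eq_prod {μ : YoungDiagram} (ν : SubDiagram μ) (n : ℕ) {R : Type*} [CommRing R]
    (x : ℕ → R) : schurSum ν.1 n x =
      ((List.range n).map fun i => stripMatrix μ (x i)).prod (SubDiagram.bot μ) ν := by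
  induction n generalizing ν with
  | zero => rw [schurSum_zero, List.range_zero, List.map_nil, List.prod_nil, Matrix.one_apply]
  | succ n ih =>
    rw [schurSum_succ, List.range_succ, List.map_append, List.prod_append, Matrix.mul_apply]
    simp only [List.map_cons, List.map_nil, List.prod_singleton, ih]

/-- Schur polynomials are invariant under reversing the order of the variables. -/
theorem schurSum_reverse (μ : YoungDiagram) (n : ℕ) {R : Type*} [CommRing R] (x y : ℕ → R)
    (hxy : ∀ i < n, y i = x (n - 1 - i)) : schurSum μ n y = schurSum μ n x := by
  have key : ∀ x : ℕ → R, schurSum μ n x = _ := schurSum_eq_prod (SubDiagram.top μ) n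
  rw [key, key]
  have hl : (List.range n).map (fun i => stripMatrix μ (y i)) =
      ((List.range n).map fun i => stripMatrix μ (x i)).reverse := by
    refine List.ext_getElem (by simp) fun i h1 h2 => ?_
    have hi : i < n := by simpa using h1
    simp [List.getElem_reverse, hxy i hi]
  rw [hl, List.Perm.prod_eq' (List.reverse_perm _)]
  rw [List.pairwise_reverse, List.pairwise_map]
  exact List.pairwise_of_forall fun a b => stripMatrix_commute μ (x b) (x a)

/-! ### The expansion in `q`-integers -/

theorem map_schurSum {R S : Type*} [CommRing R] [CommRing S] (f : R →+* S) (ν : YoungDiagram)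
    (n : ℕ) (x : ℕ → R) : f (schurSum ν n x) = schurSum ν n fun i => f (x i) := by
  simp only [schurSum, map_sum, map_prod]

theorem plethysmSL2_eq_schurSum (μ : YoungDiagram) (h : ℕ) :
    plethysmSL2 μ h = schurSum μ (h + 1) fun i => LaurentPolynomial.T ((h : ℤ) - 2 * i) := by
  rw [plethysmSL2, plethysm,
    aeval_schur μ (h + 1) (fun j => (MvPolynomial.X 0 ^ (h - j) * MvPolynomial.X 1 ^ j :
      MvPolynomial (Fin 2) ℤ)), ← AlgHom.coe_toRingHom, map_schurSum, schurSum, schurSum]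
  refine Finset.sum_congr rfl fun T _ => Finset.prod_congr rfl fun c hc => ?_
  have hlt := T.2 c hc
  simp only [RingHom.coe_coe, map_mul, map_pow, MvPolynomial.aeval_X,
    Matrix.cons_val_zero, Matrix.cons_val_one, LaurentPolynomial.T_pow]
  rw [← LaurentPolynomial.T_add]
  congr 1
  push_cast [Nat.lt_succ_iff.mp hlt]
  ring

theorem invert_plethysmSL2 (μ : YoungDiagram) (h : ℕ) :
    LaurentPolynomial.invert (plethysmSL2 μ h) = plethysmSL2 μ h := by
  rw [plethysmSL2_eq_schurSum]
  have := map_schurSum (LaurentPolynomial.invert (R := ℤ)).toAlgHom.toRingHom μ (h + 1)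
    fun i => LaurentPolynomial.T ((h : ℤ) - 2 * i)
  refine this.trans (schurSum_reverse μ (h + 1) _ _ fun i hi => ?_)
  have e : ((h + 1 - 1 - i : ℕ) : ℤ) = h - i := by omega
  change LaurentPolynomial.invert (LaurentPolynomial.T ((h : ℤ) - 2 * i)) = _
  rw [LaurentPolynomial.invert_T, e]
  congr 1
  ring

/-- Every symmetric Laurent polynomial is a combination of `q`-integers. -/
theorem exists_isQIntExpansion {f : ℤ[T;T⁻¹]} (hf : LaurentPolynomial.invert f = f) :
    ∃ a, IsQIntExpansion f a := by
  set g : ℤ[T;T⁻¹] := (LaurentPolynomial.T 1 - LaurentPolynomial.T (-1)) * f with hg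
  have hanti : ∀ n : ℤ, g.coeff (-n) = -g.coeff n := by
    intro n
    have : LaurentPolynomial.invert g = -g := by
      rw [hg, map_mul, hf, map_sub, LaurentPolynomial.invert_T, LaurentPolynomial.invert_T, neg_neg]
      ring
    rw [← LaurentPolynomial.invert_apply, this, AddMonoidAlgebra.coeff_neg, Finsupp.neg_apply]
  set a : ℕ →₀ ℤ := g.coeff.comapDomain (fun n : ℕ => (n : ℤ)) Nat.cast_injective.injOn with ha
  have ha_apply : ∀ k, a k = g.coeff (k : ℤ) := fun k => rfl
  have ha0 : a 0 = 0 := by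
    have := hanti 0
    rw [neg_zero] at this
    rw [ha_apply, Nat.cast_zero]
    omega
  refine ⟨a, ha0, ?_⟩
  have hne : (LaurentPolynomial.T 1 - LaurentPolynomial.T (-1) : ℤ[T;T⁻¹]) ≠ 0 := by
    intro h
    have := congrArg (fun p : ℤ[T;T⁻¹] => p.coeff 1) h
    simp at this
  refine mul_left_cancel₀ hne ?_
  rw [← hg, Finsupp.sum, Finset.mul_sum]
  simp only [mul_smul_comm, mul_qInt]
  have hpos : ∀ n : ℕ, (∑ k ∈ a.support, a k • (LaurentPolynomial.T (k : ℤ) -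
      LaurentPolynomial.T (-(k : ℤ)) : ℤ[T;T⁻¹])).coeff (n : ℤ) = g.coeff (n : ℤ) := by
    intro n
    rw [AddMonoidAlgebra.coeff_sum, Finsupp.finsetSum_apply, Finset.sum_eq_single n]
    · rw [AddMonoidAlgebra.coeff_smul_apply, AddMonoidAlgebra.coeff_sub, Finsupp.sub_apply,
        LaurentPolynomial.T_apply, LaurentPolynomial.T_apply, if_pos rfl, ← ha_apply]
      rcases Nat.eq_zero_or_pos n with rfl | hn
      · simp [ha0]
      · rw [if_neg (by omega)]; simp
    · intro k hk hkn
      rcases Nat.eq_zero_or_pos k with rfl | hk0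
      · simp [ha0]
      · rw [AddMonoidAlgebra.coeff_smul_apply, AddMonoidAlgebra.coeff_sub, Finsupp.sub_apply,
          LaurentPolynomial.T_apply, LaurentPolynomial.T_apply, if_neg (by omega),
          if_neg (by omega)]
        simp
    · intro hn
      rw [Finsupp.notMem_support_iff.mp hn, zero_smul]
      rfl
  have hanti' : ∀ n : ℤ, (∑ k ∈ a.support, a k • (LaurentPolynomial.T (k : ℤ) -
      LaurentPolynomial.T (-(k : ℤ)) : ℤ[T;T⁻¹])).coeff (-n) =
      -(∑ k ∈ a.support, a k • (LaurentPolynomial.T (k : ℤ) -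
        LaurentPolynomial.T (-(k : ℤ)) : ℤ[T;T⁻¹])).coeff n := by
    intro n
    rw [← LaurentPolynomial.invert_apply, ← Finsupp.neg_apply, ← AddMonoidAlgebra.coeff_neg,
      map_sum, ← Finset.sum_neg_distrib]
    congr 2
    refine Finset.sum_congr rfl fun k _ => ?_
    rw [map_zsmul, map_sub, LaurentPolynomial.invert_T, LaurentPolynomial.invert_T, neg_neg,
      ← smul_neg, neg_sub]
  refine LaurentPolynomial.ext fun n => ?_
  obtain ⟨m, rfl | rfl⟩ := n.eq_nat_or_neg
  · exact (hpos m).symm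
  · rw [hanti, hanti', hpos]

/-- The coefficient of `z ^ h` in `A_μ(z, q)`, a polynomial in `q`. -/
noncomputable def coeffPoly (μ : YoungDiagram) (h : ℕ) : Polynomial ℚ :=
  (qIntCoeffs (plethysmSL2 μ h)).sum fun k c => Polynomial.C (c : ℚ) * Polynomial.X ^ k

theorem coeff_coeffPoly (μ : YoungDiagram) (h k : ℕ) :
    (coeffPoly μ h).coeff k = plethysmCoeff μ h k := by
  rw [coeffPoly, Finsupp.sum, Polynomial.finsetSum_coeff, plethysmCoeff]
  simp only [Polynomial.coeff_C_mul_X_pow]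
  rw [Finset.sum_ite_eq]
  split_ifs with hs
  · rfl
  · rw [Finsupp.notMem_support_iff.mp hs, Int.cast_zero]

theorem coeff_coeffPoly_zero (μ : YoungDiagram) (h : ℕ) : (coeffPoly μ h).coeff 0 = 0 := by
  obtain ⟨a, ha⟩ := exists_isQIntExpansion (invert_plethysmSL2 μ h)
  rw [coeff_coeffPoly, plethysmCoeff, ha.qIntCoeffs_eq, ha.1, Int.cast_zero]

/-- The numerator of the Weyl character formula: `(q - q⁻¹) s_μ[s_h](q, q⁻¹)` has the
coefficients of the `q`-integer expansion as its positive part. -/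
theorem mul_schurSum_eq (μ : YoungDiagram) (h : ℕ) :
    (LaurentPolynomial.T 1 - LaurentPolynomial.T (-1) : ℚ[T;T⁻¹]) *
      schurSum μ (h + 1) (fun i => LaurentPolynomial.T ((h : ℤ) - 2 * i)) =
    (coeffPoly μ h).toLaurent - LaurentPolynomial.invert (coeffPoly μ h).toLaurent := by
  obtain ⟨a, ha⟩ := exists_isQIntExpansion (invert_plethysmSL2 μ h)
  set φ : ℤ[T;T⁻¹] →+* ℚ[T;T⁻¹] := AddMonoidAlgebra.mapRingHom ℤ (Int.castRingHom ℚ) with hφ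
  have hT : ∀ n : ℤ, φ (LaurentPolynomial.T n) = LaurentPolynomial.T n := by
    intro n
    rw [hφ, LaurentPolynomial.T, AddMonoidAlgebra.mapRingHom_single, map_one]
    rfl
  have h1 : φ ((LaurentPolynomial.T 1 - LaurentPolynomial.T (-1)) * plethysmSL2 μ h) =
      φ ((LaurentPolynomial.T 1 - LaurentPolynomial.T (-1)) * a.sum fun k c => c • qInt k) :=
    congrArg (fun p => φ ((LaurentPolynomial.T 1 - LaurentPolynomial.T (-1)) * p)) ha.2
  rw [plethysmSL2_eq_schurSum, Finsupp.sum, Finset.mul_sum] at h1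
  simp only [mul_smul_comm, mul_qInt, map_sum, map_zsmul, map_mul, map_sub, map_schurSum, hT] at h1
  rw [h1, coeffPoly, ha.qIntCoeffs_eq, Finsupp.sum, map_sum, map_sum, ← Finset.sum_sub_distrib]
  refine Finset.sum_congr rfl fun k _ => ?_
  rw [Polynomial.toLaurent_C_mul_X_pow, map_mul, LaurentPolynomial.invert_T,
    LaurentPolynomial.invert_C, ← mul_sub, zsmul_eq_mul]
  congr 1

/-! ### The linear system satisfied by the generating functions -/

/-- The numerator of the weight `z q ^ (2 j - w)`, written as a quotient of polynomials. Here and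
below `ℚ[X][X]` is `ℚ[z][q]`: the inner variable is `z` and the outer one is `q`. The truncated
differences `2 * j - w` and `w - 2 * j` are the positive and negative parts of the exponent. -/
noncomputable def weightNum (w j : ℕ) : ℚ[X][X] :=
  Polynomial.C Polynomial.X * Polynomial.X ^ (2 * j - w)

/-- The numerator of `1 - z q ^ (2 j - w)`. -/
noncomputable def weightDen (w j : ℕ) : ℚ[X][X] :=
  Polynomial.X ^ (w - 2 * j) - weightNum w j

/-- `φ` solves the system `φ_ρ = z q ^ (2|ρ| - w) (δ_{ρμ} + ∑_ν φ_ν)`, the sum over all `ν ⊆ μ`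
with `H ρ ν`, in the ring `A` in which `z` and `q` are interpreted by `g`. -/
def IsStripSolution (μ : YoungDiagram) (H : YoungDiagram → YoungDiagram → Prop) {A : Type}
    [CommRing A] (g : ℚ[X][X] →+* A) (φ : SubDiagram μ → A) : Prop :=
  open Classical in
  ∀ ρ : SubDiagram μ, g (Polynomial.X ^ (μ.card - 2 * ρ.1.card)) * φ ρ =
    g (weightNum μ.card ρ.1.card) *
      ((if ρ = SubDiagram.top μ then 1 else 0) + ∑ ν : SubDiagram μ, if H ρ.1 ν.1 then φ ν else 0)

section

variable {μ : YoungDiagram} {H : YoungDiagram → YoungDiagram → Prop}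

open Classical in
theorem sum_strip_split (hrefl : ∀ ν, H ν ν) {A : Type} [CommRing A] (φ : SubDiagram μ → A)
    (ρ : SubDiagram μ) : ∑ ν : SubDiagram μ, (if H ρ.1 ν.1 then φ ν else 0) =
      φ ρ + ∑ ν : SubDiagram μ, if H ρ.1 ν.1 ∧ ρ ≠ ν then φ ν else 0 := by
  rw [← Finset.add_sum_erase _ _ (Finset.mem_univ ρ), if_pos (hrefl ρ.1),
    ← Finset.add_sum_erase (a := ρ) _ (fun ν : SubDiagram μ => if H ρ.1 ν.1 ∧ ρ ≠ ν then φ ν else 0)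
      (Finset.mem_univ ρ)]
  simp only [ne_eq, not_true_eq_false, and_false, if_false, zero_add]
  congr 1
  refine Finset.sum_congr rfl fun ν hν => ?_
  have : ρ ≠ ν := (Finset.ne_of_mem_erase hν).symm
  simp [this]

open Classical in
theorem strip_equation_iff (hrefl : ∀ ν, H ν ν) {A : Type} [CommRing A] (g : ℚ[X][X] →+* A)
    (φ : SubDiagram μ → A) (ρ : SubDiagram μ) :
    (g (Polynomial.X ^ (μ.card - 2 * ρ.1.card)) * φ ρ = g (weightNum μ.card ρ.1.card) *
      ((if ρ = SubDiagram.top μ then 1 else 0) +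
        ∑ ν : SubDiagram μ, if H ρ.1 ν.1 then φ ν else 0)) ↔
    g (weightDen μ.card ρ.1.card) * φ ρ = g (weightNum μ.card ρ.1.card) *
      ((if ρ = SubDiagram.top μ then 1 else 0) +
        ∑ ν : SubDiagram μ, if H ρ.1 ν.1 ∧ ρ ≠ ν then φ ν else 0) := by
  rw [sum_strip_split hrefl, weightDen, map_sub]
  constructor <;> intro h <;> linear_combination h

theorem card_lt_of_strip (hle : ∀ ν κ, H ν κ → ν ≤ κ) {ρ ν : SubDiagram μ}
    (h : H ρ.1 ν.1 ∧ ρ ≠ ν) : ρ.1.card < ν.1.card :=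
  card_lt_card_of_le_of_ne (hle _ _ h.1) fun e => h.2 (Subtype.ext e)

theorem natDegree_weightNum_le (w j : ℕ) : (weightNum w j).natDegree ≤ 2 * j - w :=
  Polynomial.natDegree_C_mul_X_pow_le _ _

theorem natDegree_weightDen_le (w j : ℕ) :
    (weightDen w j).natDegree ≤ (w - 2 * j) + (2 * j - w) := by
  refine (Polynomial.natDegree_sub_le _ _).trans (max_le ?_ ?_)
  · rw [Polynomial.natDegree_X_pow]; omega
  · exact (natDegree_weightNum_le w j).trans (by omega)

/-- The solution has a universal numerator: a polynomial, divisible by `q` and of bounded degree in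
`q`, over the product of the denominators. -/
theorem exists_stripNumerator (hle : ∀ ν κ, H ν κ → ν ≤ κ) (hrefl : ∀ ν, H ν ν)
    (hμ : 0 < μ.card) (ρ : SubDiagram μ) :
    ∃ N : ℚ[X][X], N.natDegree ≤ (2 * ρ.1.card - μ.card) + ∑ j ∈ Finset.Ico (ρ.1.card + 1)
        (μ.card + 1), ((μ.card - 2 * j) + (2 * j - μ.card)) ∧ Polynomial.X ∣ N ∧
      ∀ (A : Type) [CommRing A] (g : ℚ[X][X] →+* A) (φ : SubDiagram μ → A),
        IsStripSolution μ H g φ →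
        (∏ j ∈ Finset.Ico ρ.1.card (μ.card + 1), g (weightDen μ.card j)) * φ ρ = g N := by
  classical
  set w := μ.card with hw
  induction hn : w - ρ.1.card using Nat.strong_induction_on generalizing ρ with
  | _ n ih =>
  have hcard : ∀ ν : SubDiagram μ, ν.1.card ≤ w := fun ν => card_mono ν.2
  have ih' : ∀ ν : SubDiagram μ, H ρ.1 ν.1 ∧ ρ ≠ ν → _ := fun ν h =>
    ih (w - ν.1.card) (by have := card_lt_of_strip hle h; have := hcard ν; omega) ν rfl
  choose! N hdeg hX hN using ih'
  refine ⟨weightNum w ρ.1.card * ((if ρ = SubDiagram.top μ then 1 else 0) +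
    ∑ ν : SubDiagram μ, if H ρ.1 ν.1 ∧ ρ ≠ ν then
      (∏ j ∈ Finset.Ico (ρ.1.card + 1) ν.1.card, weightDen w j) * N ν else 0), ?_, ?_, ?_⟩
  · refine Polynomial.natDegree_mul_le.trans (Nat.add_le_add (natDegree_weightNum_le _ _) ?_)
    refine (Polynomial.natDegree_add_le _ _).trans (max_le ?_ ?_)
    · split_ifs <;> simp
    · refine Polynomial.natDegree_sum_le_of_forall_le _ _ fun ν _ => ?_
      split_ifs with h
      · have hlt := card_lt_of_strip hle h
        refine Polynomial.natDegree_mul_le.trans ?_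
        rw [← Finset.sum_Ico_consecutive _ (Nat.succ_le_of_lt hlt) (by have := hcard ν; omega)]
        refine Nat.add_le_add ?_ ?_
        · exact (Polynomial.natDegree_prod_le _ _).trans
            (Finset.sum_le_sum fun j _ => natDegree_weightDen_le w j)
        · refine (hdeg ν h).trans ?_
          rw [Finset.sum_eq_sum_Ico_succ_bot (a := ν.1.card) (by have := hcard ν; omega)]
          omega
      · simp
  · by_cases htop : ρ = SubDiagram.top μ
    · refine Dvd.dvd.mul_right ?_ _
      rw [weightNum, htop]
      refine Dvd.dvd.mul_left (dvd_pow_self _ ?_) _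
      simp only [SubDiagram.top]
      omega
    · refine Dvd.dvd.mul_left ?_ _
      rw [if_neg htop, zero_add]
      refine Finset.dvd_sum fun ν _ => ?_
      split_ifs with h
      · exact (hX ν h).mul_left _
      · exact dvd_zero _
  · intro A _ g φ hφ
    have h1 := (strip_equation_iff hrefl g φ ρ).mp (hφ ρ)
    rw [Finset.prod_eq_prod_Ico_succ_bot (by have := hcard ρ; omega)]
    rw [map_mul, map_add, map_sum, mul_right_comm, h1, mul_assoc, add_mul, Finset.sum_mul]
    congr 2
    · split_ifs with htop
      · rw [htop]
        simp [SubDiagram.top, ← hw]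
      · simp
    · refine Finset.sum_congr rfl fun ν _ => ?_
      split_ifs with h
      · have hlt := card_lt_of_strip hle h
        rw [map_mul, ← hN ν h A g φ hφ, map_prod,
          ← Finset.prod_Ico_consecutive _ (Nat.succ_le_of_lt hlt) (by have := hcard ν; omega)]
        ring
      · simp

theorem IsStripSolution.unique (hle : ∀ ν κ, H ν κ → ν ≤ κ) (hrefl : ∀ ν, H ν ν)
    (hμ : 0 < μ.card) {A : Type} [CommRing A] [IsDomain A] {g : ℚ[X][X] →+* A}
    (hg : ∀ j, g (weightDen μ.card j) ≠ 0) {φ ψ : SubDiagram μ → A}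
    (hφ : IsStripSolution μ H g φ) (hψ : IsStripSolution μ H g ψ) (ρ : SubDiagram μ) :
    φ ρ = ψ ρ := by
  obtain ⟨N, -, -, hN⟩ := exists_stripNumerator hle hrefl hμ ρ
  have h := (hN A g φ hφ).trans (hN A g ψ hψ).symm
  exact mul_left_cancel₀ (Finset.prod_ne_zero_iff.mpr fun j _ => hg j) h

theorem exists_isStripSolution (hle : ∀ ν κ, H ν κ → ν ≤ κ) (hrefl : ∀ ν, H ν ν)
    {A : Type} [Field A] {g : ℚ[X][X] →+* A} (hg : ∀ j, g (weightDen μ.card j) ≠ 0) :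
    ∃ φ : SubDiagram μ → A, IsStripSolution μ H g φ := by
  classical
  have key : ∀ n : ℕ, ∃ φ : SubDiagram μ → A, ∀ ρ : SubDiagram μ, μ.card - ρ.1.card < n →
      g (weightDen μ.card ρ.1.card) * φ ρ = g (weightNum μ.card ρ.1.card) *
      ((if ρ = SubDiagram.top μ then 1 else 0) +
        ∑ ν : SubDiagram μ, if H ρ.1 ν.1 ∧ ρ ≠ ν then φ ν else 0) := by
    intro n
    induction n with
    | zero => exact ⟨0, fun ρ h => absurd h (Nat.not_lt_zero _)⟩
    | succ n ih =>
      obtain ⟨φ, hφ⟩ := ih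
      set ψ : SubDiagram μ → A := fun ρ => if μ.card - ρ.1.card < n then φ ρ else
        g (weightNum μ.card ρ.1.card) / g (weightDen μ.card ρ.1.card) *
        ((if ρ = SubDiagram.top μ then 1 else 0) +
          ∑ ν : SubDiagram μ, if H ρ.1 ν.1 ∧ ρ ≠ ν then φ ν else 0) with hψ
      refine ⟨ψ, fun ρ hρ => ?_⟩
      have hsum : ∑ ν : SubDiagram μ, (if H ρ.1 ν.1 ∧ ρ ≠ ν then ψ ν else 0) =
          ∑ ν : SubDiagram μ, if H ρ.1 ν.1 ∧ ρ ≠ ν then φ ν else 0 := by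
        refine Finset.sum_congr rfl fun ν _ => ?_
        split_ifs with h
        · have h1 := card_lt_of_strip hle h
          have h2 : ν.1.card ≤ μ.card := card_mono ν.2
          rw [hψ]
          exact if_pos (by omega)
        · rfl
      rw [hsum]
      by_cases hlt : μ.card - ρ.1.card < n
      · rw [← hφ ρ hlt, hψ]
        simp only [hlt, if_true]
      · rw [hψ]
        simp only [hlt, if_false]
        rw [← mul_assoc, mul_div_cancel₀ _ (hg _)]
  obtain ⟨φ, hφ⟩ := key (μ.card + 1)
  exact ⟨φ, fun ρ => (strip_equation_iff hrefl g φ ρ).mpr (hφ ρ (by omega))⟩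

end

/-! ### The series solution -/

/-- The coefficients of the power series solution of the strip system for horizontal strips:
`stripSeq μ n ρ` is the coefficient of `z ^ n`. -/
noncomputable def stripSeq (μ : YoungDiagram) : ℕ → SubDiagram μ → ℚ[T;T⁻¹]
  | 0, _ => 0
  | n + 1, ρ => open Classical in
      LaurentPolynomial.T (2 * (ρ.1.card : ℤ) - μ.card) *
        ((if n = 0 ∧ ρ = SubDiagram.top μ then 1 else 0) +
          ∑ ν : SubDiagram μ, if IsHorizontalStrip ρ.1 ν.1 then stripSeq μ n ν else 0)

theorem stripMatrix_prod_eq (μ : YoungDiagram) (n : ℕ) (c : ℤ) (ρ : SubDiagram μ) :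
    ((List.range n).map fun i : ℕ => stripMatrix μ
      (LaurentPolynomial.T (c - 2 * i) : ℚ[T;T⁻¹])).prod ρ (SubDiagram.top μ) =
      LaurentPolynomial.T (-c * ρ.1.card + (c - 2 * n) * μ.card - 2 * ρ.1.card + μ.card +
        μ.card * n) * stripSeq μ (n + 1) ρ := by
  classical
  induction n generalizing c ρ with
  | zero =>
    rw [List.range_zero, List.map_nil, List.prod_nil, Matrix.one_apply, stripSeq, ← mul_assoc,
      ← LaurentPolynomial.T_add]
    simp only [stripSeq, ite_self, Finset.sum_const_zero, add_zero, true_and]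
    split_ifs with h
    · subst h
      rw [mul_one, ← LaurentPolynomial.T_zero]
      congr 1
      simp only [SubDiagram.top]
      push_cast
      ring
    · rw [mul_zero]
  | succ n ih =>
    rw [List.range_succ_eq_map, List.map_cons, List.prod_cons, List.map_map, Matrix.mul_apply]
    have e : ((fun i : ℕ => stripMatrix μ (LaurentPolynomial.T (c - 2 * i) : ℚ[T;T⁻¹])) ∘
        Nat.succ) = fun i : ℕ => stripMatrix μ
          (LaurentPolynomial.T ((c - 2) - 2 * i) : ℚ[T;T⁻¹]) := by
      funext i
      simp only [Function.comp, Nat.succ_eq_add_one]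
      congr 2
      push_cast
      ring
    rw [e, stripSeq]
    simp only [ih, Nat.succ_ne_zero, false_and, if_false, zero_add]
    rw [← mul_assoc, ← LaurentPolynomial.T_add, Finset.mul_sum]
    refine Finset.sum_congr rfl fun ν _ => ?_
    rw [stripMatrix]
    split_ifs with h
    · have hle := card_mono h.1
      rw [LaurentPolynomial.T_pow, ← mul_assoc, ← LaurentPolynomial.T_add]
      congr 2
      push_cast [hle]
      ring
    · simp

theorem stripSeq_bot (μ : YoungDiagram) (h : ℕ) : stripSeq μ (h + 2) (SubDiagram.bot μ) =
    schurSum μ (h + 1) fun i => LaurentPolynomial.T ((h : ℤ) - 2 * i) := by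
  have h1 := stripMatrix_prod_eq μ (h + 1) h (SubDiagram.bot μ)
  have h2 := schurSum_eq_prod (SubDiagram.top μ) (h + 1)
    (fun i => (LaurentPolynomial.T ((h : ℤ) - 2 * i) : ℚ[T;T⁻¹]))
  rw [← h2] at h1
  have hbot : (SubDiagram.bot μ).1.card = 0 := rfl
  have e : -(h : ℤ) * ((0 : ℕ) : ℤ) + ((h : ℤ) - 2 * ((h + 1 : ℕ) : ℤ)) * μ.card - 2 * ((0 : ℕ) : ℤ)
      + μ.card + μ.card * ((h + 1 : ℕ) : ℤ) = 0 := by push_cast; ring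
  rw [hbot, e, LaurentPolynomial.T_zero, one_mul] at h1
  exact h1.symm

theorem stripSeq_bot_one {μ : YoungDiagram} (hμ : 0 < μ.card) :
    stripSeq μ 1 (SubDiagram.bot μ) = 0 := by
  have hne : SubDiagram.bot μ ≠ SubDiagram.top μ := by
    intro e
    have : (⊥ : YoungDiagram) = μ := congrArg Subtype.val e
    rw [← this] at hμ
    exact absurd hμ (lt_irrefl 0)
  simp [stripSeq, hne]

/-- `ℚ[z][q] → ℚ[q]⟦z⟧`. -/
noncomputable def toSeries : ℚ[X][X] →+* PowerSeries ℚ[X] :=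
  Polynomial.eval₂RingHom
    (Polynomial.eval₂RingHom (PowerSeries.C.comp Polynomial.C) PowerSeries.X)
    (PowerSeries.C Polynomial.X)

theorem toSeries_X : toSeries Polynomial.X = PowerSeries.C Polynomial.X := by
  simp [toSeries]

theorem toSeries_C_X : toSeries (Polynomial.C Polynomial.X) = PowerSeries.X := by
  simp [toSeries]

theorem toSeries_C_C (r : ℚ) : toSeries (Polynomial.C (Polynomial.C r)) =
    PowerSeries.C (Polynomial.C r) := by
  simp [toSeries]

/-- `ℚ[q]⟦z⟧ → ℚ[q, q⁻¹]⟦z⟧` with `q ↦ q`. -/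
noncomputable def seriesPos : PowerSeries ℚ[X] →+* PowerSeries ℚ[T;T⁻¹] :=
  PowerSeries.map Polynomial.toLaurent

/-- `ℚ[q]⟦z⟧ → ℚ[q, q⁻¹]⟦z⟧` with `q ↦ q⁻¹`. -/
noncomputable def seriesNeg : PowerSeries ℚ[X] →+* PowerSeries ℚ[T;T⁻¹] :=
  PowerSeries.map ((LaurentPolynomial.invert (R := ℚ)).toAlgHom.toRingHom.comp
    Polynomial.toLaurent)

/-- `A_μ(z, q)` as a power series in `z` over `ℚ[q]`. -/
noncomputable def posSeries (μ : YoungDiagram) : PowerSeries ℚ[X] :=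
  PowerSeries.mk (coeffPoly μ)

/-- The antisymmetric series `(q - q⁻¹) ∑_h s_μ[s_h](q, q⁻¹) z ^ h`. -/
noncomputable def antiSeries (μ : YoungDiagram) : PowerSeries ℚ[T;T⁻¹] :=
  seriesPos (posSeries μ) - seriesNeg (posSeries μ)

theorem coeff_antiSeries (μ : YoungDiagram) (h : ℕ) : PowerSeries.coeff h (antiSeries μ) =
    (LaurentPolynomial.T 1 - LaurentPolynomial.T (-1)) * stripSeq μ (h + 2) (SubDiagram.bot μ) := by
  rw [stripSeq_bot, mul_schurSum_eq, antiSeries, map_sub, seriesPos, seriesNeg,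
    PowerSeries.coeff_map, PowerSeries.coeff_map, posSeries, PowerSeries.coeff_mk]
  rfl

theorem seriesPos_toSeries_X_pow (n : ℕ) : seriesPos (toSeries (Polynomial.X ^ n)) =
    PowerSeries.C (LaurentPolynomial.T (n : ℤ)) := by
  rw [map_pow, toSeries_X, map_pow, seriesPos, PowerSeries.map_C, Polynomial.toLaurent_X,
    ← map_pow, LaurentPolynomial.T_pow, mul_one]

theorem seriesPos_toSeries_weightNum (w j : ℕ) : seriesPos (toSeries (weightNum w j)) =
    PowerSeries.X * PowerSeries.C (LaurentPolynomial.T ((2 * j - w : ℕ) : ℤ)) := by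
  rw [weightNum, map_mul, map_mul, seriesPos_toSeries_X_pow, toSeries_C_X, seriesPos,
    PowerSeries.map_X]

theorem isStripSolution_stripSeq (μ : YoungDiagram) :
    IsStripSolution μ IsHorizontalStrip (seriesPos.comp toSeries)
      fun ρ => PowerSeries.mk fun n => stripSeq μ n ρ := by
  classical
  intro ρ
  have hle : ρ.1.card ≤ μ.card := card_mono ρ.2
  rw [RingHom.comp_apply, RingHom.comp_apply, seriesPos_toSeries_X_pow,
    seriesPos_toSeries_weightNum, mul_assoc]
  ext1 n
  rw [PowerSeries.coeff_C_mul, PowerSeries.coeff_mk]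
  rcases n with _ | n
  · rw [PowerSeries.coeff_zero_X_mul, stripSeq, mul_zero]
  · rw [PowerSeries.coeff_succ_X_mul, PowerSeries.coeff_C_mul, stripSeq, ← mul_assoc,
      ← LaurentPolynomial.T_add, map_add, map_sum]
    have e : ((μ.card - 2 * ρ.1.card : ℕ) : ℤ) + (2 * (ρ.1.card : ℤ) - μ.card) =
        ((2 * ρ.1.card - μ.card : ℕ) : ℤ) := by omega
    rw [e]
    congr 2
    · by_cases h1 : ρ = SubDiagram.top μ <;> by_cases h2 : n = 0 <;>
        simp [h1, h2, PowerSeries.coeff_one]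
    · refine Finset.sum_congr rfl fun ν _ => ?_
      split_ifs
      · rw [PowerSeries.coeff_mk]
      · rw [map_zero]

theorem mk_stripSeq_bot {μ : YoungDiagram} (hμ : 0 < μ.card) :
    PowerSeries.C (LaurentPolynomial.T 1 - LaurentPolynomial.T (-1) : ℚ[T;T⁻¹]) *
      (PowerSeries.mk fun n => stripSeq μ n (SubDiagram.bot μ)) =
      PowerSeries.X ^ 2 * antiSeries μ := by
  ext1 n
  rw [PowerSeries.coeff_C_mul, PowerSeries.coeff_mk, PowerSeries.coeff_X_pow_mul']
  rcases n with _ | _ | n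
  · simp [stripSeq]
  · simp [stripSeq_bot_one hμ]
  · rw [if_pos (by omega), show n + 1 + 1 - 2 = n from rfl, coeff_antiSeries]

/-! ### Partial fractions in `q` -/

/-- The denominator `1 - z q ^ m`, whose inverse expands in nonnegative powers of `q`. -/
noncomputable def posFactor (m : ℕ) : ℚ[X][X] := 1 - Polynomial.C Polynomial.X * Polynomial.X ^ m

/-- The denominator `q ^ m - z`, whose inverse expands in negative powers of `q`. -/
noncomputable def negFactor (m : ℕ) : ℚ[X][X] := Polynomial.X ^ m - Polynomial.C Polynomial.X

/-- The indices `j` with `2 * j < w`, for which the weight `z q ^ (2 j - w)` has a negative power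
of `q`. -/
def negIndices (w : ℕ) : Finset ℕ := (Finset.range (w + 1)).filter fun j => 2 * j < w

/-- The indices `j` with `2 * j = w`; there is one or none. -/
def midIndices (w : ℕ) : Finset ℕ := (Finset.range (w + 1)).filter fun j => 2 * j = w

/-- The product of the denominators `1 - z q ^ m`. -/
noncomputable def denPos (w : ℕ) : ℚ[X][X] := ∏ j ∈ negIndices w, posFactor (w - 2 * j)

/-- The product of the denominators `q ^ m - z`. -/
noncomputable def denNeg (w : ℕ) : ℚ[X][X] := ∏ j ∈ negIndices w, negFactor (w - 2 * j)

/-- The factors of the denominator without `q`: `1 - z` if `w` is even, `1` if `w` is odd. -/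
noncomputable def denMid (w : ℕ) : ℚ[X] := ∏ _j ∈ midIndices w, (1 - Polynomial.X)

/-- The degree in `q` of `denPos w` and of `denNeg w`. -/
def denDeg (w : ℕ) : ℕ := ∑ j ∈ negIndices w, (w - 2 * j)

@[to_additive]
theorem prod_range_split {M : Type*} [CommMonoid M] (w : ℕ) (f : ℕ → M) :
    ∏ j ∈ Finset.range (w + 1), f j =
      (∏ j ∈ negIndices w, f j) * (∏ j ∈ negIndices w, f (w - j)) * ∏ j ∈ midIndices w, f j := by
  rw [← Finset.prod_filter_mul_prod_filter_not (Finset.range (w + 1)) (fun j => 2 * j < w),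
    mul_assoc]
  congr 1
  rw [← Finset.prod_filter_mul_prod_filter_not
    ((Finset.range (w + 1)).filter fun j => ¬ 2 * j < w) (fun j => w < 2 * j)]
  congr 1
  · refine Finset.prod_bij' (fun j _ => w - j) (fun j _ => w - j) ?_ ?_ ?_ ?_ ?_
    · intro j hj
      simp only [negIndices, Finset.mem_filter, Finset.mem_range] at hj ⊢
      omega
    · intro j hj
      simp only [negIndices, Finset.mem_filter, Finset.mem_range] at hj ⊢
      omega
    · intro j hj
      simp only [Finset.mem_filter, Finset.mem_range] at hj
      omega
    · intro j hj
      simp only [negIndices, Finset.mem_filter, Finset.mem_range] at hj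
      omega
    · intro j hj
      simp only [Finset.mem_filter, Finset.mem_range] at hj
      congr 1
      omega
  · refine Finset.prod_congr ?_ fun _ _ => rfl
    ext j
    simp only [midIndices, Finset.mem_filter, Finset.mem_range]
    omega

theorem prod_weightDen (w : ℕ) : ∏ j ∈ Finset.Ico 0 (w + 1), weightDen w j =
    denNeg w * denPos w * Polynomial.C (denMid w) := by
  rw [Nat.Ico_zero_eq_range, prod_range_split, denNeg, denPos, denMid, map_prod]
  refine congrArg₂ (· * ·) (congrArg₂ (· * ·) ?_ ?_) ?_
  · refine Finset.prod_congr rfl fun j hj => ?_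
    simp only [negIndices, Finset.mem_filter, Finset.mem_range] at hj
    rw [weightDen, weightNum, negFactor, show 2 * j - w = 0 by omega, pow_zero, mul_one]
  · refine Finset.prod_congr rfl fun j hj => ?_
    simp only [negIndices, Finset.mem_filter, Finset.mem_range] at hj
    rw [weightDen, weightNum, posFactor, show w - 2 * (w - j) = 0 by omega, pow_zero,
      show 2 * (w - j) - w = w - 2 * j by omega]
  · refine Finset.prod_congr rfl fun j hj => ?_
    simp only [midIndices, Finset.mem_filter, Finset.mem_range] at hj
    rw [weightDen, weightNum, show w - 2 * j = 0 by omega, show 2 * j - w = 0 by omega, pow_zero,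
      mul_one, map_sub, map_one]

theorem sum_degrees (w : ℕ) : w + ∑ j ∈ Finset.Ico 1 (w + 1), ((w - 2 * j) + (2 * j - w)) =
    2 * denDeg w := by
  have h0 : ∑ j ∈ Finset.range (w + 1), ((w - 2 * j) + (2 * j - w)) =
      w + ∑ j ∈ Finset.Ico 1 (w + 1), ((w - 2 * j) + (2 * j - w)) := by
    rw [← Nat.Ico_zero_eq_range, Finset.sum_eq_sum_Ico_succ_bot (Nat.succ_pos w)]
    simp
  rw [← h0, sum_range_split, denDeg, two_mul]
  have h1 : ∑ j ∈ midIndices w, ((w - 2 * j) + (2 * j - w)) = 0 := by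
    refine Finset.sum_eq_zero fun j hj => ?_
    simp only [midIndices, Finset.mem_filter, Finset.mem_range] at hj
    omega
  rw [h1, add_zero]
  congr 1 <;> refine Finset.sum_congr rfl fun j hj => ?_ <;>
    simp only [negIndices, Finset.mem_filter, Finset.mem_range] at hj <;> omega

theorem denMid_ne_zero (w : ℕ) : denMid w ≠ 0 :=
  Finset.prod_ne_zero_iff.mpr fun _ _ h => by
    have := congrArg (Polynomial.eval 0) h
    simp at this

theorem monic_negFactor {m : ℕ} (hm : 0 < m) : (negFactor m).Monic :=
  Polynomial.monic_X_pow_sub_C _ hm.ne'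

theorem monic_denNeg (w : ℕ) : (denNeg w).Monic :=
  Polynomial.monic_prod_of_monic _ _ fun j hj => monic_negFactor (by
    simp only [negIndices, Finset.mem_filter, Finset.mem_range] at hj
    omega)

theorem natDegree_denNeg (w : ℕ) : (denNeg w).natDegree = denDeg w := by
  rw [denNeg, Polynomial.natDegree_prod_of_monic, denDeg]
  · exact Finset.sum_congr rfl fun j _ => Polynomial.natDegree_X_pow_sub_C
  · intro j hj
    simp only [negIndices, Finset.mem_filter, Finset.mem_range] at hj
    exact monic_negFactor (by omega)

theorem natDegree_denPos_le (w : ℕ) : (denPos w).natDegree ≤ denDeg w := by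
  refine (Polynomial.natDegree_prod_le _ _).trans (Finset.sum_le_sum fun j _ => ?_)
  refine (Polynomial.natDegree_sub_le _ _).trans
    (max_le ?_ (Polynomial.natDegree_C_mul_X_pow_le _ _))
  simp

theorem posFactor_ne_zero (m : ℕ) : posFactor m ≠ 0 := fun h => by
  have := congrArg (Polynomial.eval (0 : ℚ)) (congrArg (Polynomial.eval (0 : ℚ[X])) h)
  by_cases hm : m = 0 <;> simp [posFactor, hm] at this

theorem denPos_ne_zero (w : ℕ) : denPos w ≠ 0 :=
  Finset.prod_ne_zero_iff.mpr fun _ _ => posFactor_ne_zero _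

/-- `a` and `b` become coprime after inverting a nonzero polynomial in `z`. -/
def GenericallyCoprime (a b : ℚ[X][X]) : Prop :=
  ∃ c : ℚ[X], c ≠ 0 ∧ ∃ u v, Polynomial.C c = u * a + v * b

theorem GenericallyCoprime.symm {a b : ℚ[X][X]} (h : GenericallyCoprime a b) :
    GenericallyCoprime b a := by
  obtain ⟨c, hc, u, v, e⟩ := h
  exact ⟨c, hc, v, u, by rw [e]; ring⟩

theorem GenericallyCoprime.mul_right {a b b' : ℚ[X][X]} (h : GenericallyCoprime a b)
    (h' : GenericallyCoprime a b') : GenericallyCoprime a (b * b') := by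
  obtain ⟨c, hc, u, v, e⟩ := h
  obtain ⟨c', hc', u', v', e'⟩ := h'
  exact ⟨c * c', mul_ne_zero hc hc', u * u' * a + u * v' * b' + v * b * u', v * v', by
    rw [map_mul, e, e']; ring⟩

theorem GenericallyCoprime.prod_right {a : ℚ[X][X]} {s : Finset ℕ} {f : ℕ → ℚ[X][X]}
    (h : ∀ j ∈ s, GenericallyCoprime a (f j)) : GenericallyCoprime a (∏ j ∈ s, f j) := by
  classical
  induction s using Finset.induction_on with
  | empty => exact ⟨1, one_ne_zero, 0, 1, by simp⟩
  | insert j s hj ih =>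
    rw [Finset.prod_insert hj]
    exact (h j (Finset.mem_insert_self _ _)).mul_right
      (ih fun i hi => h i (Finset.mem_insert_of_mem hi))

/-- A common root of `1 - z q ^ m` and `q ^ n - z` would satisfy
`z ^ m = q ^ (m n) = z ^ (-n)`; so `1 - z ^ (n + m)` lies in the ideal they generate. -/
theorem genericallyCoprime_posFactor_negFactor {m n : ℕ} (hm : 0 < m) :
    GenericallyCoprime (posFactor m) (negFactor n) := by
  obtain ⟨u, hu⟩ : posFactor m ∣
      (1 : ℚ[X][X]) ^ n - (Polynomial.C Polynomial.X * Polynomial.X ^ m) ^ n :=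
    sub_dvd_pow_sub_pow _ _ n
  obtain ⟨v, hv⟩ : negFactor n ∣
      ((Polynomial.X : ℚ[X][X]) ^ n) ^ m - (Polynomial.C Polynomial.X) ^ m :=
    sub_dvd_pow_sub_pow _ _ m
  refine ⟨1 - Polynomial.X ^ (n + m), ?_, u, Polynomial.C Polynomial.X ^ n * v, ?_⟩
  · intro h
    have := congrArg (Polynomial.eval 0) h
    simp [hm.ne'] at this
  · rw [mul_comm u, mul_assoc, mul_comm v, ← hu, ← hv, map_sub, map_one, map_pow, mul_pow, one_pow,
      pow_add, ← pow_mul, ← pow_mul, mul_comm m n]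
    ring

theorem exists_partialFraction {w : ℕ} {M : ℚ[X][X]}
    (hM : M.natDegree < 2 * denDeg w) :
    ∃ c : ℚ[X], c ≠ 0 ∧ ∃ P Q : ℚ[X][X], Polynomial.C c * M = P * denNeg w + Q * denPos w ∧
      P.natDegree < denDeg w ∧ Q.natDegree < denDeg w := by
  have hcop : GenericallyCoprime (denPos w) (denNeg w) := by
    refine GenericallyCoprime.prod_right fun i hi => GenericallyCoprime.symm
      (GenericallyCoprime.prod_right fun j hj => GenericallyCoprime.symm ?_)
    simp only [negIndices, Finset.mem_filter, Finset.mem_range] at hi hj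
    exact genericallyCoprime_posFactor_negFactor (by omega)
  obtain ⟨c, hc, u, v, e⟩ := hcop
  have hd : 0 < denDeg w := by omega
  have hQ : ((u * M) %ₘ denNeg w).natDegree < denDeg w := by
    rw [← natDegree_denNeg]
    refine Polynomial.natDegree_modByMonic_lt _ (monic_denNeg w) fun h => ?_
    have := natDegree_denNeg w
    rw [h, Polynomial.natDegree_one] at this
    omega
  have hmod := Polynomial.modByMonic_add_div (u * M) (denNeg w)
  set Q := (u * M) %ₘ denNeg w with hQdef
  set P := v * M + ((u * M) /ₘ denNeg w) * denPos w with hPdef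
  have key : Polynomial.C c * M = P * denNeg w + Q * denPos w := by
    rw [e, hPdef]
    linear_combination (-denPos w) * hmod
  refine ⟨c, hc, P, Q, key, ?_, hQ⟩
  by_cases hP : P = 0
  · rw [hP, Polynomial.natDegree_zero]; exact hd
  have h1 : (P * denNeg w).natDegree = P.natDegree + denDeg w := by
    rw [mul_comm, (monic_denNeg w).natDegree_mul' hP, natDegree_denNeg, add_comm]
  have h2 : P * denNeg w = Polynomial.C c * M - Q * denPos w := by rw [key]; ring
  have h3 : (P * denNeg w).natDegree < 2 * denDeg w := by
    rw [h2]
    refine (Polynomial.natDegree_sub_le _ _).trans_lt (max_lt ?_ ?_)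
    · exact (Polynomial.natDegree_C_mul_le _ _).trans_lt hM
    · refine Polynomial.natDegree_mul_le.trans_lt ?_
      have := natDegree_denPos_le w
      omega
  omega

/-! ### Extracting the positive part -/

/-- `(q - q⁻¹) φ_∅` has a universal numerator, of small degree in `q`. The degree bound is where
`1 < |μ|` enters. -/
theorem exists_weylNumerator {μ : YoungDiagram} (hμ : 1 < μ.card) :
    ∃ M : ℚ[X][X], M.natDegree < 2 * denDeg μ.card ∧
      ∀ (A : Type) [CommRing A] (g : ℚ[X][X] →+* A) (φ : SubDiagram μ → A),
        IsStripSolution μ IsHorizontalStrip g φ →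
        g (denNeg μ.card * denPos μ.card * Polynomial.C (denMid μ.card)) *
          (g (Polynomial.X ^ 2 - 1) * φ (SubDiagram.bot μ)) = g Polynomial.X * g M := by
  obtain ⟨N, hdeg, ⟨N', rfl⟩, hN⟩ := exists_stripNumerator (H := IsHorizontalStrip)
    (fun _ _ h => h.1) IsHorizontalStrip.refl (Nat.zero_lt_of_lt hμ) (SubDiagram.bot μ)
  have hbot : (SubDiagram.bot μ).1.card = 0 := rfl
  rw [hbot] at hdeg
  simp only [mul_zero, Nat.zero_sub, Nat.zero_add] at hdeg
  refine ⟨(Polynomial.X ^ 2 - 1) * N', ?_, fun A _ g φ hφ => ?_⟩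
  · have hs := sum_degrees μ.card
    refine Polynomial.natDegree_mul_le.trans_lt ?_
    have h2 : (Polynomial.X ^ 2 - 1 : ℚ[X][X]).natDegree ≤ 2 := by
      refine (Polynomial.natDegree_sub_le _ _).trans (by simp)
    by_cases h0 : N' = 0
    · rw [h0, Polynomial.natDegree_zero]
      have : μ.card - 2 * μ.card + (2 * μ.card - μ.card) ≤
          ∑ j ∈ Finset.Ico 1 (μ.card + 1), ((μ.card - 2 * j) + (2 * j - μ.card)) :=
        Finset.single_le_sum (f := fun j => (μ.card - 2 * j) + (2 * j - μ.card))
          (fun _ _ => Nat.zero_le _) (Finset.mem_Ico.mpr ⟨by omega, by omega⟩)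
      omega
    · rw [Polynomial.natDegree_X_mul h0] at hdeg
      omega
  · have h1 := hN A g φ hφ
    rw [hbot, ← map_prod, prod_weightDen, map_mul g Polynomial.X] at h1
    rw [map_mul g (Polynomial.X ^ 2 - 1)]
    linear_combination (g (Polynomial.X ^ 2 - 1)) * h1

theorem isUnit_C_T (n : ℤ) : IsUnit (PowerSeries.C (LaurentPolynomial.T n : ℚ[T;T⁻¹])) :=
  (LaurentPolynomial.isUnit_T n).map _

theorem antiSeries_mul_eq {μ : YoungDiagram} (hμ : 0 < μ.card) {M : ℚ[X][X]}
    (hM : ∀ (A : Type) [CommRing A] (g : ℚ[X][X] →+* A) (φ : SubDiagram μ → A),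
        IsStripSolution μ IsHorizontalStrip g φ →
        g (denNeg μ.card * denPos μ.card * Polynomial.C (denMid μ.card)) *
          (g (Polynomial.X ^ 2 - 1) * φ (SubDiagram.bot μ)) = g Polynomial.X * g M) :
    seriesPos (toSeries (denNeg μ.card * denPos μ.card *
      Polynomial.C (Polynomial.X ^ 2 * denMid μ.card))) * antiSeries μ =
      seriesPos (toSeries M) := by
  have h1 := hM _ (seriesPos.comp toSeries) _ (isStripSolution_stripSeq μ)
  have h2 := mk_stripSeq_bot hμ
  have hX : seriesPos (toSeries Polynomial.X) = PowerSeries.C (LaurentPolynomial.T 1) := by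
    simpa using seriesPos_toSeries_X_pow 1
  have hX2 : seriesPos (toSeries (Polynomial.X ^ 2 - 1)) = PowerSeries.C (LaurentPolynomial.T 1) *
      PowerSeries.C (LaurentPolynomial.T 1 - LaurentPolynomial.T (-1) : ℚ[T;T⁻¹]) := by
    rw [map_sub, map_sub, seriesPos_toSeries_X_pow, map_one, map_one, ← map_mul, mul_sub,
      ← LaurentPolynomial.T_add, ← LaurentPolynomial.T_add, map_sub]
    simp
  simp only [RingHom.comp_apply] at h1
  rw [hX2, hX, mul_assoc (PowerSeries.C (LaurentPolynomial.T 1)), h2] at h1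
  have hz : seriesPos (toSeries (Polynomial.C (Polynomial.X ^ 2))) = PowerSeries.X ^ 2 := by
    rw [map_pow, map_pow, map_pow, toSeries_C_X, seriesPos, PowerSeries.map_X]
  refine (isUnit_C_T 1).mul_left_cancel ?_
  have e : denNeg μ.card * denPos μ.card * Polynomial.C (Polynomial.X ^ 2 * denMid μ.card) =
      denNeg μ.card * denPos μ.card * Polynomial.C (denMid μ.card) *
        Polynomial.C (Polynomial.X ^ 2) := by
    rw [map_mul]; ring
  rw [← h1, e, map_mul toSeries _ (Polynomial.C (Polynomial.X ^ 2)), map_mul seriesPos, hz]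
  ring

theorem seriesPos_comp_toSeries : seriesPos.comp toSeries = Polynomial.eval₂RingHom
    (Polynomial.eval₂RingHom (PowerSeries.C.comp LaurentPolynomial.C) PowerSeries.X)
    (PowerSeries.C (LaurentPolynomial.T 1 : ℚ[T;T⁻¹])) := by
  refine Polynomial.ringHom_ext' (Polynomial.ringHom_ext' ?_ ?_) ?_
  · ext1 r
    simp [toSeries, seriesPos]
  · simp [toSeries, seriesPos]
  · simp [toSeries, seriesPos]

theorem seriesNeg_comp_toSeries : seriesNeg.comp toSeries = Polynomial.eval₂RingHom
    (Polynomial.eval₂RingHom (PowerSeries.C.comp LaurentPolynomial.C) PowerSeries.X)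
    (PowerSeries.C (LaurentPolynomial.T (-1) : ℚ[T;T⁻¹])) := by
  refine Polynomial.ringHom_ext' (Polynomial.ringHom_ext' ?_ ?_) ?_
  · ext1 r
    simp [toSeries, seriesNeg]
  · simp [toSeries, seriesNeg]
  · simp [toSeries, seriesNeg]

theorem seriesPos_toSeries_C (c : ℚ[X]) : seriesPos (toSeries (Polynomial.C c)) =
    seriesNeg (toSeries (Polynomial.C c)) := by
  change seriesPos.comp toSeries _ = seriesNeg.comp toSeries _
  rw [seriesPos_comp_toSeries, seriesNeg_comp_toSeries]
  simp

theorem seriesPos_toSeries_C_ne_zero {c : ℚ[X]} (hc : c ≠ 0) :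
    seriesPos (toSeries (Polynomial.C c)) ≠ 0 := by
  have h : seriesPos (toSeries (Polynomial.C c)) =
      PowerSeries.map LaurentPolynomial.C (c : PowerSeries ℚ) := by
    change (seriesPos.comp toSeries).comp Polynomial.C c =
      (PowerSeries.map LaurentPolynomial.C).comp Polynomial.coeToPowerSeries.ringHom c
    refine congrArg (fun f : ℚ[X] →+* PowerSeries ℚ[T;T⁻¹] => f c) (Polynomial.ringHom_ext' ?_ ?_)
    · ext1 r
      simp [seriesPos_comp_toSeries]
    · simp [seriesPos_comp_toSeries]
  have hinj : Function.Injective (LaurentPolynomial.C : ℚ →+* ℚ[T;T⁻¹]) := RingHom.injective _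
  rw [h]
  intro h0
  have h1 := (map_eq_zero_iff _ (PowerSeries.map_injective _ hinj)).mp h0
  exact hc (Polynomial.coe_eq_zero_iff.mp h1)

/-- `Q(z, q) = q ^ d Q^*(z, q⁻¹)`, where `Q^*` is the reflection of `Q`. -/
theorem seriesPos_toSeries_eq_reflect {d : ℕ} {Q : ℚ[X][X]} (hQ : Q.natDegree ≤ d) :
    seriesPos (toSeries Q) = PowerSeries.C (LaurentPolynomial.T (d : ℤ)) *
      seriesNeg (toSeries (Polynomial.reflect d Q)) := by
  rw [← RingHom.comp_apply, ← RingHom.comp_apply, seriesPos_comp_toSeries, seriesNeg_comp_toSeries]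
  let inv : Invertible (PowerSeries.C (LaurentPolynomial.T 1 : ℚ[T;T⁻¹])) :=
    { invOf := PowerSeries.C (LaurentPolynomial.T (-1))
      invOf_mul_self := by rw [← map_mul, ← LaurentPolynomial.T_add]; simp
      mul_invOf_self := by rw [← map_mul, ← LaurentPolynomial.T_add]; simp }
  have := Polynomial.eval₂_reflect_mul_pow
    (Polynomial.eval₂RingHom (PowerSeries.C.comp LaurentPolynomial.C) PowerSeries.X)
    (PowerSeries.C (LaurentPolynomial.T 1 : ℚ[T;T⁻¹])) d Q hQ
  rw [← map_pow, LaurentPolynomial.T_pow, mul_one] at this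
  rw [Polynomial.coe_eval₂RingHom, Polynomial.coe_eval₂RingHom, ← this, mul_comm]
  rfl

theorem seriesPos_toSeries_denNeg (w : ℕ) : seriesPos (toSeries (denNeg w)) =
    PowerSeries.C (LaurentPolynomial.T (denDeg w : ℤ)) * seriesNeg (toSeries (denPos w)) := by
  have h : PowerSeries.C (LaurentPolynomial.T (denDeg w : ℤ) : ℚ[T;T⁻¹]) =
      ∏ j ∈ negIndices w, PowerSeries.C (LaurentPolynomial.T ((w - 2 * j : ℕ) : ℤ)) := by
    simp only [← seriesPos_toSeries_X_pow]
    rw [← map_prod, ← map_prod, Finset.prod_pow_eq_pow_sum, denDeg]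
  rw [h, denNeg, denPos, map_prod, map_prod, map_prod, map_prod, ← Finset.prod_mul_distrib]
  refine Finset.prod_congr rfl fun j _ => ?_
  have hT : ∀ n : ℕ, seriesNeg (toSeries (Polynomial.X ^ n)) =
      PowerSeries.C (LaurentPolynomial.T (-(n : ℤ))) := by
    intro n
    rw [← RingHom.comp_apply, seriesNeg_comp_toSeries, map_pow, Polynomial.coe_eval₂RingHom,
      Polynomial.eval₂_X, ← map_pow, LaurentPolynomial.T_pow, mul_neg_one]
  rw [negFactor, posFactor, map_sub, map_sub, seriesPos_toSeries_X_pow, map_sub, map_sub, map_mul,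
    map_mul, hT, map_one, map_one, seriesPos_toSeries_C, mul_sub, mul_one, mul_left_comm,
    ← map_mul PowerSeries.C, ← LaurentPolynomial.T_add]
  simp

theorem isUnit_toSeries_denPos (w : ℕ) : IsUnit (toSeries (denPos w)) := by
  rw [denPos, map_prod]
  refine IsUnit.prod_iff.mpr fun j _ => ?_
  rw [PowerSeries.isUnit_iff_constantCoeff, posFactor, map_sub, map_mul, map_one, toSeries_C_X]
  simp

/-- The coefficient of `q ^ 0` of a series over `ℚ[q]`. -/
noncomputable def seriesConst : PowerSeries ℚ[X] →+* PowerSeries ℚ :=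
  PowerSeries.map Polynomial.constantCoeff

theorem seriesConst_toSeries (P : ℚ[X][X]) :
    seriesConst (toSeries P) = ((P.coeff 0 : ℚ[X]) : PowerSeries ℚ) := by
  have : seriesConst.comp toSeries =
      (Polynomial.coeToPowerSeries.ringHom (R := ℚ)).comp Polynomial.constantCoeff := by
    refine Polynomial.ringHom_ext' (Polynomial.ringHom_ext' ?_ ?_) ?_
    · ext1 r
      simp [toSeries, seriesConst]
    · simp [toSeries, seriesConst]
    · simp [toSeries, seriesConst]
  exact congrArg (fun f => f P) this

theorem seriesConst_posSeries (μ : YoungDiagram) : seriesConst (posSeries μ) = 0 := by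
  ext n
  rw [seriesConst, PowerSeries.coeff_map, posSeries, PowerSeries.coeff_mk,
    Polynomial.constantCoeff_apply, coeff_coeffPoly_zero, map_zero]

/-- A series that has both only nonnegative and only nonpositive powers of `q` is constant
in `q`, hence zero if its constant coefficient in `q` is. -/
theorem eq_zero_of_seriesPos_eq_seriesNeg {x y : PowerSeries ℚ[X]}
    (h : seriesPos x = seriesNeg y) (h0 : seriesConst x = 0 ∨ seriesConst y = 0) : x = 0 := by
  have hc : ∀ n k : ℕ, (PowerSeries.coeff n x).coeff k =
      if k = 0 then (PowerSeries.coeff n y).coeff 0 else 0 := by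
    intro n k
    have h1 := congrArg (fun s => (PowerSeries.coeff n s).coeff (k : ℤ)) h
    simp only [seriesPos, seriesNeg, PowerSeries.coeff_map] at h1
    change (Polynomial.toLaurent (PowerSeries.coeff n x)).coeff (k : ℤ) =
      (LaurentPolynomial.invert (Polynomial.toLaurent (PowerSeries.coeff n y))).coeff (k : ℤ) at h1
    rw [LaurentPolynomial.invert_apply] at h1
    have hl : ∀ (p : ℚ[X]) (i : ℕ), (Polynomial.toLaurent p).coeff (i : ℤ) = p.coeff i := by
      intro p i
      rw [LaurentPolynomial.coeff_toLaurent]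
      exact Finsupp.mapDomain_apply Nat.cast_injective _ _
    have hl' : ∀ (p : ℚ[X]) (i : ℕ), i ≠ 0 → (Polynomial.toLaurent p).coeff (-(i : ℤ)) = 0 := by
      intro p i hi
      rw [LaurentPolynomial.coeff_toLaurent]
      refine Finsupp.mapDomain_of_notMem_range _ _ ?_
      rintro ⟨m, hm⟩
      have hm' : (m : ℤ) = -(i : ℤ) := hm
      omega
    rw [hl] at h1
    split_ifs with hk
    · subst hk
      rw [h1]
      simpa using hl (PowerSeries.coeff n y) 0
    · rw [h1, hl' _ _ hk]
  have hx0 : ∀ n, (PowerSeries.coeff n x).coeff 0 = 0 := by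
    intro n
    rcases h0 with h0 | h0
    · have := congrArg (PowerSeries.coeff n) h0
      simpa [seriesConst, PowerSeries.coeff_map] using this
    · have := congrArg (PowerSeries.coeff n) h0
      rw [hc, if_pos rfl]
      simpa [seriesConst, PowerSeries.coeff_map] using this
  ext n k
  rw [map_zero, Polynomial.coeff_zero]
  by_cases hk : k = 0
  · rw [hk, hx0]
  · rw [hc, if_neg hk]

theorem cross_mul_of_partialFraction {B : Type*} [CommRing B] {t γ δ δ' a a' p q : B}
    (h : γ * (t * δ' * δ * (a - a')) = p * (t * δ') + t * q * δ) :
    t * ((γ * δ * a - p) * δ') = t * ((γ * δ' * a' + q) * δ) := by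
  linear_combination h

theorem mul_eq_mul_of_cross_mul {B : Type*} [CommRing B] {x y δ δ' u u' : B}
    (h : x * δ' = y * δ) (hu : δ * u = 1) (hu' : δ' * u' = 1) : x * u = y * u' := by
  linear_combination (u * u') * h - x * u * hu' + y * u' * hu

/-- The first term of a partial fraction decomposition of the antisymmetric series is its positive
part: `A_μ = P / (c ∏ (1 - z q ^ m))`. -/
theorem mul_posSeries_eq {μ : YoungDiagram} {M P Q : ℚ[X][X]} {c : ℚ[X]}
    (hM : seriesPos (toSeries (denNeg μ.card * denPos μ.card *
      Polynomial.C (Polynomial.X ^ 2 * denMid μ.card))) * antiSeries μ = seriesPos (toSeries M))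
    (hPQ : Polynomial.C c * M = (P * denNeg μ.card + Q * denPos μ.card) *
      Polynomial.C (Polynomial.X ^ 2 * denMid μ.card))
    (hQ : Q.natDegree ≤ denDeg μ.card) (h0 : P.coeff 0 = 0 ∨ Q.natDegree < denDeg μ.card) :
    toSeries (Polynomial.C c * denPos μ.card) * posSeries μ = toSeries P := by
  have h1 := congrArg seriesPos (congrArg toSeries hPQ)
  simp only [map_mul toSeries, map_mul seriesPos, map_add toSeries, map_add seriesPos] at h1 hM
  have hne : seriesPos (toSeries (Polynomial.C (Polynomial.X ^ 2 * denMid μ.card))) ≠ 0 :=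
    seriesPos_toSeries_C_ne_zero (mul_ne_zero (pow_ne_zero _ Polynomial.X_ne_zero)
      (denMid_ne_zero _))
  rw [← hM] at h1
  have h2 : seriesPos (toSeries (Polynomial.C c)) * (seriesPos (toSeries (denNeg μ.card)) *
      seriesPos (toSeries (denPos μ.card)) * antiSeries μ) =
      seriesPos (toSeries P) * seriesPos (toSeries (denNeg μ.card)) +
        seriesPos (toSeries Q) * seriesPos (toSeries (denPos μ.card)) := by
    refine mul_right_cancel₀ hne ?_
    rw [← h1]
    ring
  rw [seriesPos_toSeries_denNeg, seriesPos_toSeries_eq_reflect hQ, antiSeries] at h2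
  set q' := toSeries (Polynomial.reflect (denDeg μ.card) Q) with hq'
  obtain ⟨u, hu⟩ := isUnit_toSeries_denPos μ.card
  have hu1 : toSeries (denPos μ.card) * (↑u⁻¹ : PowerSeries ℚ[X]) = 1 := by rw [← hu]; simp
  have hup := congrArg seriesPos hu1
  have hun := congrArg seriesNeg hu1
  rw [map_mul, map_one] at hup hun
  have h3 : seriesPos (toSeries (Polynomial.C c * denPos μ.card) * posSeries μ - toSeries P) *
      seriesNeg (toSeries (denPos μ.card)) =
      seriesNeg (toSeries (Polynomial.C c * denPos μ.card) * posSeries μ + q') *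
      seriesPos (toSeries (denPos μ.card)) := by
    refine (isUnit_C_T (denDeg μ.card)).mul_left_cancel ?_
    rw [map_sub seriesPos, map_add seriesNeg, map_mul toSeries, map_mul seriesPos,
      map_mul seriesNeg, map_mul seriesPos, map_mul seriesNeg, ← seriesPos_toSeries_C c]
    exact cross_mul_of_partialFraction h2
  have h4 := eq_zero_of_seriesPos_eq_seriesNeg
    (x := (toSeries (Polynomial.C c * denPos μ.card) * posSeries μ - toSeries P) * ↑u⁻¹)
    (y := (toSeries (Polynomial.C c * denPos μ.card) * posSeries μ + q') * ↑u⁻¹) ?_ ?_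
  · exact sub_eq_zero.mp (u⁻¹.isUnit.mul_left_eq_zero.mp h4)
  · rw [map_mul seriesPos, map_mul seriesNeg]
    exact mul_eq_mul_of_cross_mul h3 hup hun
  · rcases h0 with h0 | h0
    · left
      rw [map_mul seriesConst, map_sub, map_mul seriesConst _ (posSeries μ), seriesConst_posSeries,
        mul_zero, seriesConst_toSeries, h0]
      simp
    · right
      rw [map_mul seriesConst, map_add, map_mul seriesConst _ (posSeries μ), seriesConst_posSeries,
        mul_zero, hq', seriesConst_toSeries, Polynomial.coeff_reflect,
        Polynomial.revAt_le (Nat.zero_le _),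
        Nat.sub_zero, Polynomial.coeff_eq_zero_of_natDegree_lt h0]
      simp

/-! ### Polynomials, power series and rational functions in `z` and `q` -/

/-- The identification `ℚ[z][q] → ℚ[z, q]`. -/
noncomputable def toMv : ℚ[X][X] →+* MvPolynomial (Fin 2) ℚ :=
  Polynomial.eval₂RingHom (Polynomial.eval₂RingHom MvPolynomial.C (MvPolynomial.X 0))
    (MvPolynomial.X 1)

theorem toMv_injective : Function.Injective toMv := by
  have h : (MvPolynomial.eval₂Hom (Polynomial.C.comp Polynomial.C)
      ![Polynomial.C Polynomial.X, Polynomial.X]).comp toMv = RingHom.id ℚ[X][X] := by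
    refine Polynomial.ringHom_ext' (Polynomial.ringHom_ext' ?_ ?_) ?_
    · ext1 r
      simp [toMv]
    · simp [toMv]
    · simp [toMv]
  exact Function.LeftInverse.injective
    (g := MvPolynomial.eval₂Hom (Polynomial.C.comp Polynomial.C)
      ![Polynomial.C Polynomial.X, Polynomial.X]) fun p => congrArg (fun f : _ →+* _ => f p) h

/-- A power series in `z` over `ℚ[q]` as a power series in `z` and `q`. -/
noncomputable def toMvSeries (f : PowerSeries ℚ[X]) : MvPowerSeries (Fin 2) ℚ :=
  fun n => (PowerSeries.coeff (n 0) f).coeff (n 1)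

theorem coeff_toMvSeries (f : PowerSeries ℚ[X]) (n : Fin 2 →₀ ℕ) :
    MvPowerSeries.coeff n (toMvSeries f) = (PowerSeries.coeff (n 0) f).coeff (n 1) := rfl

theorem toMvSeries_posSeries (μ : YoungDiagram) : toMvSeries (posSeries μ) = genFun μ := by
  ext n
  rw [coeff_toMvSeries, posSeries, PowerSeries.coeff_mk, coeff_coeffPoly]
  rfl

theorem single_le_iff {n : Fin 2 →₀ ℕ} {i : Fin 2} : Finsupp.single i 1 ≤ n ↔ n i ≠ 0 := by
  rw [Finsupp.single_le_iff, Nat.one_le_iff_ne_zero]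

/-- `toMvSeries` is linear over the polynomials. -/
theorem toMvSeries_mul (p : ℚ[X][X]) (f : PowerSeries ℚ[X]) :
    toMvSeries (toSeries p * f) = (toMv p : MvPowerSeries (Fin 2) ℚ) * toMvSeries f := by
  have hadd : ∀ f g, toMvSeries (f + g) = toMvSeries f + toMvSeries g := by
    intro f g
    ext n
    simp [coeff_toMvSeries]
  have hC : ∀ (r : ℚ) f, toMvSeries (PowerSeries.C (Polynomial.C r) * f) =
      MvPowerSeries.C r * toMvSeries f := by
    intro r f
    ext n
    rw [MvPowerSeries.coeff_C_mul, coeff_toMvSeries, coeff_toMvSeries, PowerSeries.coeff_C_mul,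
      Polynomial.coeff_C_mul]
  have hz : ∀ f, toMvSeries (PowerSeries.X * f) = MvPowerSeries.X 0 * toMvSeries f := by
    intro f
    ext n
    rw [MvPowerSeries.X, MvPowerSeries.coeff_monomial_mul, coeff_toMvSeries]
    simp only [single_le_iff]
    split_ifs with h
    · obtain ⟨m, hm⟩ := Nat.exists_eq_succ_of_ne_zero h
      rw [hm, PowerSeries.coeff_succ_X_mul, coeff_toMvSeries]
      simp [hm]
    · rw [not_not.mp h, PowerSeries.coeff_zero_X_mul, Polynomial.coeff_zero]
  have hq : ∀ f, toMvSeries (PowerSeries.C Polynomial.X * f) =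
      MvPowerSeries.X 1 * toMvSeries f := by
    intro f
    ext n
    rw [MvPowerSeries.X, MvPowerSeries.coeff_monomial_mul, coeff_toMvSeries,
      PowerSeries.coeff_C_mul]
    simp only [single_le_iff]
    split_ifs with h
    · obtain ⟨m, hm⟩ := Nat.exists_eq_succ_of_ne_zero h
      rw [hm, Polynomial.coeff_X_mul, coeff_toMvSeries]
      simp [hm]
    · rw [not_not.mp h, Polynomial.coeff_X_mul_zero]
  have hinner : ∀ (a : ℚ[X]) f, toMvSeries (toSeries (Polynomial.C a) * f) =
      (toMv (Polynomial.C a) : MvPowerSeries (Fin 2) ℚ) * toMvSeries f := by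
    intro a
    induction a using Polynomial.induction_on' with
    | add a b ha hb =>
      intro f
      rw [map_add, map_add, map_add, MvPolynomial.coe_add, add_mul, hadd, ha, hb, add_mul]
    | monomial n r =>
      induction n with
      | zero =>
        intro f
        rw [Polynomial.monomial_zero_left, toSeries_C_C, hC]
        simp [toMv]
      | succ n ih =>
        intro f
        rw [← Polynomial.X_mul_monomial, map_mul, map_mul, map_mul, mul_assoc, toSeries_C_X, hz, ih,
          MvPolynomial.coe_mul, mul_assoc]
        congr 1
        simp [toMv]
  induction p using Polynomial.induction_on' generalizing f with
  | add p r hp hr =>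
    rw [map_add, map_add, MvPolynomial.coe_add, add_mul, hadd, hp, hr, add_mul]
  | monomial n a =>
    induction n generalizing f with
    | zero => rw [Polynomial.monomial_zero_left, hinner]
    | succ n ih =>
      rw [← Polynomial.X_mul_monomial, map_mul, map_mul, mul_assoc, toSeries_X, hq, ih,
        MvPolynomial.coe_mul, mul_assoc]
      congr 1
      simp [toMv]

theorem toMvSeries_toSeries (p : ℚ[X][X]) :
    toMvSeries (toSeries p) = (toMv p : MvPowerSeries (Fin 2) ℚ) := by
  have h := toMvSeries_mul p 1
  have h1 : toMvSeries 1 = 1 := by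
    ext n
    rw [coeff_toMvSeries, PowerSeries.coeff_one, MvPowerSeries.coeff_one]
    have hn : n = 0 ↔ n 0 = 0 ∧ n 1 = 0 := by
      rw [Finsupp.ext_iff, Fin.forall_fin_two]
      rfl
    by_cases h0 : n 0 = 0 <;> by_cases h1 : n 1 = 0 <;> simp [hn, h0, h1, Polynomial.coeff_one]
  rwa [mul_one, h1, mul_one] at h

/-- The inclusion `ℚ[z][q] → ℚ(z, q)`. -/
noncomputable def toRatFun : ℚ[X][X] →+* RatFun :=
  (algebraMap (MvPolynomial (Fin 2) ℚ) RatFun).comp toMv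

theorem toRatFun_injective : Function.Injective toRatFun :=
  (IsFractionRing.injective (MvPolynomial (Fin 2) ℚ) RatFun).comp toMv_injective

theorem toRatFun_ne_zero {p : ℚ[X][X]} (hp : p ≠ 0) : toRatFun p ≠ 0 :=
  (map_ne_zero_iff _ toRatFun_injective).mpr hp

theorem toRatFun_X : toRatFun Polynomial.X = qVar := by simp [toRatFun, toMv, qVar]

theorem toRatFun_C_X : toRatFun (Polynomial.C Polynomial.X) = zVar := by
  simp [toRatFun, toMv, zVar]

theorem zVar_ne_zero : zVar ≠ 0 := by
  rw [← toRatFun_C_X]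
  exact toRatFun_ne_zero (Polynomial.C_ne_zero.mpr Polynomial.X_ne_zero)

theorem qVar_ne_zero : qVar ≠ 0 := by
  rw [← toRatFun_X]
  exact toRatFun_ne_zero Polynomial.X_ne_zero

theorem isExpansionOf_genFun {μ : YoungDiagram} {D P : ℚ[X][X]} (hD : D ≠ 0)
    (h : toSeries D * posSeries μ = toSeries P) :
    IsExpansionOf (genFun μ) (toRatFun P / toRatFun D) := by
  refine ⟨toMv P, toMv D, (map_ne_zero_iff _ toMv_injective).mpr hD, ?_, rfl⟩
  rw [← toMvSeries_posSeries, ← toMvSeries_mul, h, toMvSeries_toSeries]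

theorem weightDen_ne_zero (w j : ℕ) : weightDen w j ≠ 0 := fun h => by
  have := congrArg (Polynomial.eval (0 : ℚ)) (congrArg (Polynomial.eval (1 : ℚ[X])) h)
  simp [weightDen, weightNum] at this

/-! ### Inverting the variables -/

theorem toRatFun_C (p : ℚ[X]) :
    toRatFun (Polynomial.C p) = Polynomial.eval₂ (algebraMap ℚ RatFun) zVar p := by
  have : toRatFun.comp Polynomial.C = Polynomial.eval₂RingHom (algebraMap ℚ RatFun) zVar := by
    refine Polynomial.ringHom_ext' (Subsingleton.elim _ _) ?_
    simp [toRatFun_C_X]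
  exact congrArg (fun f : ℚ[X] →+* RatFun => f p) this

theorem invVars_toRatFun_C {t : ℕ} {p : ℚ[X]} (hp : p.natDegree ≤ t) :
    toRatFun (Polynomial.C (Polynomial.reflect t p)) =
      zVar ^ t * invVars (toRatFun (Polynomial.C p)) := by
  have hz := zVar_ne_zero
  rw [toRatFun_C, toRatFun_C, Polynomial.hom_eval₂, invVars_zVar,
    Subsingleton.elim (invVars.comp (algebraMap ℚ RatFun)) (algebraMap ℚ RatFun)]
  let inv : Invertible (zVar⁻¹) := invertibleOfNonzero (inv_ne_zero hz)
  have := Polynomial.eval₂_reflect_mul_pow (algebraMap ℚ RatFun) zVar⁻¹ t p hp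
  rw [invOf_eq_inv, inv_inv] at this
  rw [← this, mul_left_comm, ← mul_pow, mul_inv_cancel₀ hz, one_pow, mul_one]

/-- Up to a monomial, inverting `z` and `q` preserves polynomials of `q`-degree at most `d`. -/
theorem exists_reflection (d : ℕ) (P : ℚ[X][X]) (hP : P.natDegree ≤ d) : ∃ t₀ : ℕ, ∀ t ≥ t₀,
    ∃ P' : ℚ[X][X], toRatFun P' = zVar ^ t * qVar ^ d * invVars (toRatFun P) ∧
      P'.natDegree ≤ d ∧ (P.natDegree < d → P'.coeff 0 = 0) := by
  refine ⟨(Finset.range (d + 1)).sup fun i => (P.coeff i).natDegree, fun t ht => ?_⟩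
  have ht' : ∀ i ∈ Finset.range (d + 1), (P.coeff i).natDegree ≤ t := fun i hi =>
    (Finset.le_sup (f := fun i => (P.coeff i).natDegree) hi).trans ht
  refine ⟨∑ i ∈ Finset.range (d + 1), Polynomial.C (Polynomial.reflect t (P.coeff i)) *
    Polynomial.X ^ (d - i), ?_, ?_, ?_⟩
  · conv_rhs => rw [P.as_sum_range_C_mul_X_pow' (Nat.lt_succ_of_le hP)]
    rw [map_sum, map_sum, map_sum, Finset.mul_sum]
    refine Finset.sum_congr rfl fun i hi => ?_
    have hid : i ≤ d := Nat.lt_succ_iff.mp (Finset.mem_range.mp hi)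
    rw [map_mul, map_mul, map_mul, invVars_toRatFun_C (ht' i hi), map_pow, map_pow, map_pow,
      toRatFun_X, invVars_qVar]
    have : qVar ^ (d - i) = qVar ^ d * qVar⁻¹ ^ i := by
      rw [inv_pow, pow_sub₀ _ qVar_ne_zero hid]
    rw [this]
    ring
  · exact Polynomial.natDegree_sum_le_of_forall_le _ _ fun i _ =>
      (Polynomial.natDegree_C_mul_X_pow_le _ _).trans (Nat.sub_le _ _)
  · intro hlt
    rw [Polynomial.finsetSum_coeff]
    refine Finset.sum_eq_zero fun i hi => ?_
    rw [Polynomial.coeff_C_mul_X_pow]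
    split_ifs with h
    · have : d ≤ i := by omega
      rw [Polynomial.coeff_eq_zero_of_natDegree_lt (hlt.trans_le this), Polynomial.reflect_zero]
    · rfl

theorem invVars_posFactor (m : ℕ) : toRatFun (posFactor m) =
    -zVar * qVar ^ m * invVars (toRatFun (posFactor m)) := by
  have hz := zVar_ne_zero
  have hq := pow_ne_zero m qVar_ne_zero
  rw [posFactor, map_sub, map_mul, map_pow, map_one, toRatFun_X, toRatFun_C_X, map_sub, map_mul,
    map_pow, map_one, invVars_zVar, invVars_qVar, inv_pow]
  field_simp
  ring

theorem invVars_negFactor (m : ℕ) : toRatFun (negFactor m) =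
    -zVar * qVar ^ m * invVars (toRatFun (negFactor m)) := by
  have hz := zVar_ne_zero
  have hq := pow_ne_zero m qVar_ne_zero
  rw [negFactor, map_sub, map_pow, toRatFun_X, toRatFun_C_X, map_sub, map_pow, invVars_zVar,
    invVars_qVar, inv_pow]
  field_simp
  ring

theorem invVars_denPos (w : ℕ) : toRatFun (denPos w) =
    (-zVar) ^ (negIndices w).card * qVar ^ denDeg w * invVars (toRatFun (denPos w)) := by
  rw [denPos, map_prod, map_prod, denDeg, ← Finset.prod_pow_eq_pow_sum, ← Finset.prod_const,
    ← Finset.prod_mul_distrib, ← Finset.prod_mul_distrib]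
  exact Finset.prod_congr rfl fun j _ => invVars_posFactor _

theorem invVars_denNeg (w : ℕ) : toRatFun (denNeg w) =
    (-zVar) ^ (negIndices w).card * qVar ^ denDeg w * invVars (toRatFun (denNeg w)) := by
  rw [denNeg, map_prod, map_prod, denDeg, ← Finset.prod_pow_eq_pow_sum, ← Finset.prod_const,
    ← Finset.prod_mul_distrib, ← Finset.prod_mul_distrib]
  exact Finset.prod_congr rfl fun j _ => invVars_negFactor _

theorem invVars_denMid (w : ℕ) : toRatFun (Polynomial.C (denMid w)) =
    (-zVar) ^ (midIndices w).card * invVars (toRatFun (Polynomial.C (denMid w))) := by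
  rw [denMid, map_prod, map_prod, map_prod, ← Finset.prod_const, ← Finset.prod_mul_distrib]
  refine Finset.prod_congr rfl fun j _ => ?_
  have hz := zVar_ne_zero
  rw [map_sub, map_one, map_sub, map_one, toRatFun_C_X, map_sub, map_one, invVars_zVar]
  field_simp
  ring

/-! ### Reciprocity -/

/-- The weight `z q ^ (2 j - w)`. -/
noncomputable def weight (w j : ℕ) : RatFun := zVar * qVar ^ (2 * (j : ℤ) - w)

theorem weight_ne_zero (w j : ℕ) : weight w j ≠ 0 :=
  mul_ne_zero zVar_ne_zero (zpow_ne_zero _ qVar_ne_zero)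

theorem invVars_weight (w j : ℕ) : invVars (weight w j) = (weight w j)⁻¹ := by
  rw [weight, map_mul, map_zpow₀, invVars_zVar, invVars_qVar, mul_inv, inv_zpow]

theorem toRatFun_weightNum (w j : ℕ) :
    toRatFun (weightNum w j) = toRatFun (Polynomial.X ^ (w - 2 * j)) * weight w j := by
  rw [weightNum, map_mul, map_pow, map_pow, toRatFun_C_X, toRatFun_X, weight, mul_left_comm,
    ← zpow_natCast, ← zpow_natCast, ← zpow_add₀ qVar_ne_zero]
  congr 2
  omega

open Classical in
theorem isStripSolution_toRatFun_iff {μ : YoungDiagram}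
    {H : YoungDiagram → YoungDiagram → Prop} {φ : SubDiagram μ → RatFun} :
    IsStripSolution μ H toRatFun φ ↔ ∀ ρ : SubDiagram μ, φ ρ = weight μ.card ρ.1.card *
      ((if ρ = SubDiagram.top μ then 1 else 0) +
        ∑ ν : SubDiagram μ, if H ρ.1 ν.1 then φ ν else 0) := by
  refine forall_congr' fun ρ => ?_
  rw [toRatFun_weightNum, mul_assoc]
  exact mul_right_inj' (toRatFun_ne_zero (pow_ne_zero _ Polynomial.X_ne_zero))

theorem neg_one_pow_mul_self' (n : ℕ) : ((-1 : RatFun) ^ n) * (-1) ^ n = 1 := by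
  rw [← mul_pow]; simp

/-- Inverting the variables turns the solution for vertical strips into the solution for horizontal
strips: with `U` the diagonal matrix of weights and `S` that of signs, `ψ = U (e + V ψ)` gives
`U ψ̄ = e + V ψ̄`, and `H S V = S` shows that `S (U ψ̄ - e)` solves the horizontal system up to a
scalar. -/
theorem isStripSolution_invVars {μ : YoungDiagram} {ψ : SubDiagram μ → RatFun}
    (hψ : IsStripSolution μ IsVerticalStrip toRatFun ψ) :
    IsStripSolution μ IsHorizontalStrip toRatFun fun ρ =>
      -(-1) ^ (μ.card + ρ.1.card) * weight μ.card μ.card *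
        (weight μ.card ρ.1.card * invVars (ψ ρ) - if ρ = SubDiagram.top μ then 1 else 0) := by
  classical
  rw [isStripSolution_toRatFun_iff] at hψ ⊢
  set w := μ.card with hw
  have hinv : ∀ ν : SubDiagram μ, weight w ν.1.card * invVars (ψ ν) -
      (if ν = SubDiagram.top μ then 1 else 0) =
      ∑ κ : SubDiagram μ, (if IsVerticalStrip ν.1 κ.1 then 1 else 0) * invVars (ψ κ) := by
    intro ν
    conv_lhs => rw [hψ ν]
    rw [map_mul, invVars_weight, ← mul_assoc, mul_inv_cancel₀ (weight_ne_zero _ _), one_mul,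
      map_add, map_sum]
    have h1 : invVars (if ν = SubDiagram.top μ then 1 else 0) =
        if ν = SubDiagram.top μ then 1 else 0 := by split_ifs <;> simp
    rw [h1, add_sub_cancel_left]
    refine Finset.sum_congr rfl fun κ _ => ?_
    split_ifs <;> simp
  intro ρ
  have hsum : ∑ ν : SubDiagram μ, (if IsHorizontalStrip ρ.1 ν.1 then
      -(-1) ^ (w + ν.1.card) * weight w w *
        (weight w ν.1.card * invVars (ψ ν) - if ν = SubDiagram.top μ then 1 else 0) else 0) =
      -(-1) ^ w * weight w w * ((-1) ^ ρ.1.card * invVars (ψ ρ)) := by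
    have h1 : ∀ ν : SubDiagram μ, (if IsHorizontalStrip ρ.1 ν.1 then
        -(-1) ^ (w + ν.1.card) * weight w w *
          (weight w ν.1.card * invVars (ψ ν) - if ν = SubDiagram.top μ then 1 else 0) else 0) =
        ∑ κ : SubDiagram μ, (-(-1) ^ w * weight w w) * (((if IsHorizontalStrip ρ.1 ν.1 then
          (1 : RatFun) else 0) * (-1) ^ ν.1.card * (if IsVerticalStrip ν.1 κ.1 then 1 else 0)) *
            invVars (ψ κ)) := by
      intro ν
      rw [hinv ν]
      split_ifs
      · rw [Finset.mul_sum]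
        refine Finset.sum_congr rfl fun κ _ => ?_
        rw [pow_add]
        ring
      · simp
    rw [Finset.sum_congr rfl fun ν _ => h1 ν, Finset.sum_comm]
    have h2 : ∀ κ : SubDiagram μ, ∑ ν : SubDiagram μ, (-(-1) ^ w * weight w w) *
        (((if IsHorizontalStrip ρ.1 ν.1 then
          (1 : RatFun) else 0) * (-1) ^ ν.1.card * (if IsVerticalStrip ν.1 κ.1 then 1 else 0)) *
            invVars (ψ κ)) = if ρ = κ then
          -(-1) ^ w * weight w w * ((-1) ^ ρ.1.card * invVars (ψ κ)) else 0 := by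
      intro κ
      rw [← Finset.mul_sum, ← Finset.sum_mul, sum_neg_one_pow_horizontal_vertical]
      split_ifs <;> ring
    rw [Finset.sum_congr rfl fun κ _ => h2 κ, Finset.sum_ite_eq, if_pos (Finset.mem_univ _)]
  rw [hsum, pow_add]
  split_ifs with htop
  · subst htop
    have h1 : (SubDiagram.top μ).1.card = w := rfl
    rw [h1]
    linear_combination (weight w w) * neg_one_pow_mul_self' w
  · ring

/-- A solution for horizontal strips below `μ`, transposed, is a solution for vertical strips below
the transpose of `μ`. -/
theorem IsStripSolution.transpose {μ : YoungDiagram} {φ : SubDiagram μ → RatFun}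
    (hφ : IsStripSolution μ IsHorizontalStrip toRatFun φ) :
    IsStripSolution μ.transpose IsVerticalStrip toRatFun fun ρ =>
      φ ⟨ρ.1.transpose, YoungDiagram.transpose_le_iff.mp (by simpa using ρ.2)⟩ := by
  classical
  rw [isStripSolution_toRatFun_iff] at hφ ⊢
  let e : SubDiagram μ.transpose ≃ SubDiagram μ :=
    { toFun := fun ρ => ⟨ρ.1.transpose, YoungDiagram.transpose_le_iff.mp (by simpa using ρ.2)⟩
      invFun := fun ρ => ⟨ρ.1.transpose, YoungDiagram.transpose_le_iff.mpr ρ.2⟩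
      left_inv := fun ρ => Subtype.ext (YoungDiagram.transpose_transpose _)
      right_inv := fun ρ => Subtype.ext (YoungDiagram.transpose_transpose _) }
  intro ρ
  change φ (e ρ) = weight μ.transpose.card ρ.1.card *
    ((if ρ = SubDiagram.top μ.transpose then 1 else 0) +
      ∑ ν : SubDiagram μ.transpose, if IsVerticalStrip ρ.1 ν.1 then φ (e ν) else 0)
  rw [hφ (e ρ), card_transpose]
  have h1 : (e ρ).1.card = ρ.1.card := card_transpose _
  have h2 : e ρ = SubDiagram.top μ ↔ ρ = SubDiagram.top μ.transpose := by
    rw [← e.apply_eq_iff_eq (x := ρ)]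
    have : e (SubDiagram.top μ.transpose) = SubDiagram.top μ :=
      Subtype.ext (YoungDiagram.transpose_transpose _)
    rw [this]
  rw [h1, ← e.sum_comp]
  congr 2
  · simp only [h2]
  · refine Finset.sum_congr rfl fun ν _ => ?_
    have h3 : IsHorizontalStrip (e ρ).1 (e ν).1 ↔ IsVerticalStrip ρ.1 ν.1 :=
      isHorizontalStrip_transpose
    simp only [h3]

/-- Reciprocity for the bottom entries of the solutions, which are `z ^ 2` times the generating
functions of the principal specializations of `s_μ` and `s_{μ'}`. -/
theorem reciprocity_bot {μ : YoungDiagram} (hμ : 0 < μ.card) {φ : SubDiagram μ → RatFun}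
    {φ' : SubDiagram μ.transpose → RatFun}
    (hφ : IsStripSolution μ IsHorizontalStrip toRatFun φ)
    (hφ' : IsStripSolution μ.transpose IsHorizontalStrip toRatFun φ') :
    φ' (SubDiagram.bot μ.transpose) =
      -(-1) ^ μ.card * zVar ^ 2 * invVars (φ (SubDiagram.bot μ)) := by
  have hpos : 0 < μ.transpose.card := by rwa [card_transpose]
  have h := hφ'.unique (fun _ _ h => h.1) IsHorizontalStrip.refl hpos
    (fun j => toRatFun_ne_zero (weightDen_ne_zero _ j)) (isStripSolution_invVars hφ.transpose)
    (SubDiagram.bot μ.transpose)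
  have hne : SubDiagram.bot μ.transpose ≠ SubDiagram.top μ.transpose := by
    intro e
    have : (⊥ : YoungDiagram) = μ.transpose := congrArg Subtype.val e
    rw [← this] at hpos
    exact absurd hpos (lt_irrefl 0)
  have hbot : (⟨(SubDiagram.bot μ.transpose).1.transpose, YoungDiagram.transpose_le_iff.mp
      (by simpa using (SubDiagram.bot μ.transpose).2)⟩ : SubDiagram μ) = SubDiagram.bot μ := by
    refine Subtype.ext (YoungDiagram.ext ?_)
    simp [SubDiagram.bot, YoungDiagram.transpose]
  have hc : (SubDiagram.bot μ.transpose).1.card = 0 := rfl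
  rw [h, if_neg hne, hc, hbot, card_transpose, sub_zero, add_zero]
  have hw : weight μ.card μ.card * weight μ.card 0 = zVar ^ 2 := by
    rw [weight, weight, mul_mul_mul_comm, ← zpow_add₀ qVar_ne_zero, ← sq]
    have : (2 * (μ.card : ℤ) - μ.card + (2 * ((0 : ℕ) : ℤ) - μ.card)) = 0 := by push_cast; ring
    rw [this, zpow_zero, mul_one]
  rw [← hw]
  ring

/-! ### Transporting the decomposition -/

/-- The algebra of inverting a partial fraction decomposition. The letters `p`, `r`, `c`, `m`, `dp`,
`dn`, `dm` stand for inverted polynomials, and the monomials `t * d`, `s`, `y * d`, `y'` make them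
polynomials again; `f` and `f'` are the two sides of the reciprocity `reciprocity_bot`. -/
theorem partialFraction_reciprocity {K : Type*} [Field K]
    {q z y y' ε d s t Dp Dn Dm dp dn dm c M m p r f f' : K} (hq : q ≠ 0) (hε : ε * ε = 1)
    (hDp : Dp = y * d * dp) (hDn : Dn = y * d * dn) (hDm : Dm = y' * dm)
    (hpf : c * m = p * dn + r * dp) (hm : dn * dp * dm * ((q⁻¹ ^ 2 - 1) * f) = q⁻¹ * m)
    (hM : Dn * Dp * Dm * ((q ^ 2 - 1) * f') = q * M) (hf : f' = -ε * z ^ 2 * f) :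
    ε * t * (s * c) * M = s * z ^ 2 * (y * y') * (t * d * p * Dn + t * d * r * Dp) := by
  have h1 : q * m = dn * dp * dm * ((1 - q ^ 2) * f) := by
    field_simp at hm
    linear_combination -hm
  have h2 : M = ε * z ^ 2 * y ^ 2 * y' * d ^ 2 * m := by
    refine mul_left_cancel₀ hq ?_
    rw [← hM, hDp, hDn, hDm, hf]
    linear_combination (-(ε * z ^ 2 * y ^ 2 * y' * d ^ 2)) * h1
  rw [h2, hDn, hDp]
  linear_combination (t * s * z ^ 2 * y ^ 2 * y' * d ^ 2) * hpf +
    (t * s * c * z ^ 2 * y ^ 2 * y' * d ^ 2 * m) * hε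

/-- The companion of `partialFraction_reciprocity` for the first term of the decomposition. -/
theorem quotient_reciprocity {K : Type*} [Field K] {z y y' ε d s t dp dm c p : K}
    (hε : ε * ε = 1) (hz : z ≠ 0) (hy : y ≠ 0) (hy' : y' ≠ 0) (hd : d ≠ 0) (hs : s ≠ 0)
    (ht : t ≠ 0) (hdp : dp ≠ 0) (hdm : dm ≠ 0) (hc : c ≠ 0) :
    p / (z⁻¹ ^ 2 * dm * c * dp) = ε * z ^ 2 * (s * z ^ 2 * (y * y') * (t * d * p) /
      (ε * t * z ^ 2 * (y' * dm) * (s * c) * (y * d * dp))) := by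
  have hε0 : ε ≠ 0 := fun h => by simp [h] at hε
  field_simp

/-- The partial fraction decomposition for `μ` yields, after inverting the variables, one for the
transpose of `μ`; the first terms of both are the required rational functions. -/
theorem exists_reciprocal_expansions {μ : YoungDiagram} (hμ : 1 < μ.card) :
    ∃ R R' : RatFun, IsExpansionOf (genFun μ) R ∧ IsExpansionOf (genFun μ.transpose) R' ∧
      invVars R = (-1) ^ μ.card * zVar ^ 2 * R' := by
  have hμ' : 1 < μ.transpose.card := by rwa [card_transpose]
  obtain ⟨M, hMdeg, hM⟩ := exists_weylNumerator hμ
  obtain ⟨M', -, hM'⟩ := exists_weylNumerator hμ'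
  have hser := antiSeries_mul_eq (Nat.zero_lt_of_lt hμ) hM
  have hser' := antiSeries_mul_eq (Nat.zero_lt_of_lt hμ') hM'
  obtain ⟨c, hc, P, Q, hPQ, hP, hQ⟩ := exists_partialFraction hMdeg
  have hden : ∀ {μ : YoungDiagram} (j : ℕ), toRatFun (weightDen μ.card j) ≠ 0 :=
    fun j => toRatFun_ne_zero (weightDen_ne_zero _ j)
  obtain ⟨φ, hφ⟩ := exists_isStripSolution (μ := μ) (H := IsHorizontalStrip)
    (fun _ _ h => h.1) IsHorizontalStrip.refl hden
  obtain ⟨φ', hφ'⟩ := exists_isStripSolution (μ := μ.transpose) (H := IsHorizontalStrip)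
    (fun _ _ h => h.1) IsHorizontalStrip.refl hden
  have hrec := reciprocity_bot (Nat.zero_lt_of_lt hμ) hφ hφ'
  have hK := congrArg invVars (hM _ toRatFun φ hφ)
  have hK' := hM' _ toRatFun φ' hφ'
  rw [card_transpose] at hK' hser'
  set w := μ.card with hw
  obtain ⟨t₁, ht₁⟩ := exists_reflection (denDeg w) P hP.le
  obtain ⟨t₂, ht₂⟩ := exists_reflection (denDeg w) Q hQ.le
  set t := max t₁ t₂
  obtain ⟨P', hP', -, hP'0⟩ := ht₁ t (le_max_left _ _)
  obtain ⟨Q', hQ', hQ'deg, -⟩ := ht₂ t (le_max_right _ _)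
  set s := c.natDegree
  have hc' := invVars_toRatFun_C (le_refl s)
  set k := (negIndices w).card
  set k' := (midIndices w).card
  have hpf := congrArg invVars (congrArg toRatFun hPQ)
  simp only [map_mul, map_add, map_sub, map_pow, map_one, toRatFun_X, invVars_qVar] at hK hK' hpf
  have hsign : ((-1 : RatFun) ^ w) * (-1) ^ w = 1 := neg_one_pow_mul_self' w
  have hkey := partialFraction_reciprocity (s := zVar ^ s) (t := zVar ^ t) qVar_ne_zero hsign
    (invVars_denPos w) (invVars_denNeg w) (invVars_denMid w) hpf hK hK' hrec
  -- The decomposition of the series of `μ`.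
  have hexp := mul_posSeries_eq (c := Polynomial.X ^ 2 * denMid w * c) hser
    (by rw [map_mul Polynomial.C _ c, mul_assoc, hPQ, mul_comm]) hQ.le (Or.inr hQ)
  have hmid := denMid_ne_zero w
  have hX2 : (Polynomial.X ^ 2 * denMid w : ℚ[X]) ≠ 0 :=
    mul_ne_zero (pow_ne_zero _ Polynomial.X_ne_zero) hmid
  -- The decomposition of the series of the transpose, by inverting the variables in the former.
  set c' : ℚ[X] := (-1) ^ w * Polynomial.X ^ t * (Polynomial.X ^ 2 * denMid w) *
    Polynomial.reflect s c with hc'def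
  set e : ℚ[X] := Polynomial.X ^ s * Polynomial.X ^ 2 * ((-Polynomial.X) ^ k *
    (-Polynomial.X) ^ k') with hedef
  have hc'_img : toRatFun (Polynomial.C c') = (-1) ^ w * zVar ^ t * zVar ^ 2 *
      toRatFun (Polynomial.C (denMid w)) * (zVar ^ s * invVars (toRatFun (Polynomial.C c))) := by
    rw [hc'def, ← hc']
    simp only [map_mul, map_pow, map_neg, map_one, toRatFun_C_X]
    ring
  have he_img : toRatFun (Polynomial.C e) =
      zVar ^ s * zVar ^ 2 * ((-zVar) ^ k * (-zVar) ^ k') := by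
    rw [hedef]
    simp only [map_mul, map_pow, map_neg, toRatFun_C_X]
  have hPQ' : Polynomial.C c' * M' = (Polynomial.C e * P' * denNeg w +
      Polynomial.C e * Q' * denPos w) * Polynomial.C (Polynomial.X ^ 2 * denMid w) := by
    apply toRatFun_injective
    simp only [map_mul toRatFun, map_add toRatFun, map_mul Polynomial.C, map_pow Polynomial.C,
      map_pow toRatFun, hc'_img, he_img, hP', hQ', toRatFun_C_X]
    linear_combination (zVar ^ 2 * toRatFun (Polynomial.C (denMid w))) * hkey
  have hexp' := mul_posSeries_eq (μ := μ.transpose) (c := c') (M := M')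
    (P := Polynomial.C e * P') (Q := Polynomial.C e * Q')
    (by rw [card_transpose]; exact hser') (by rw [card_transpose]; exact hPQ')
    (by rw [card_transpose]; exact (Polynomial.natDegree_C_mul_le _ _).trans hQ'deg)
    (Or.inl (by rw [Polynomial.coeff_C_mul, hP'0 hP, mul_zero]))
  rw [card_transpose] at hexp'
  have hc'0 : c' ≠ 0 := by
    refine mul_ne_zero (mul_ne_zero (mul_ne_zero (pow_ne_zero _ (neg_ne_zero.mpr one_ne_zero))
      (pow_ne_zero _ Polynomial.X_ne_zero)) hX2) ?_
    rw [Ne, Polynomial.reflect_eq_zero_iff]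
    exact hc
  have hinj : Function.Injective invVars := invVars.injective
  have hne : ∀ {p : ℚ[X][X]}, p ≠ 0 → invVars (toRatFun p) ≠ 0 := fun hp =>
    (map_ne_zero_iff _ hinj).mpr (toRatFun_ne_zero hp)
  have hC : ∀ {a : ℚ[X]}, a ≠ 0 → Polynomial.C a ≠ 0 := fun h => Polynomial.C_ne_zero.mpr h
  refine ⟨_, _, isExpansionOf_genFun (mul_ne_zero (hC (mul_ne_zero hX2 hc)) (denPos_ne_zero w))
    hexp, isExpansionOf_genFun (mul_ne_zero (hC hc'0) (denPos_ne_zero w)) hexp', ?_⟩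
  have hnz := neg_ne_zero.mpr zVar_ne_zero
  have hfin := quotient_reciprocity (p := invVars (toRatFun P)) hsign zVar_ne_zero
    (pow_ne_zero k hnz) (pow_ne_zero k' hnz) (pow_ne_zero (denDeg w) qVar_ne_zero)
    (pow_ne_zero s zVar_ne_zero) (pow_ne_zero t zVar_ne_zero) (hne (denPos_ne_zero w))
    (hne (hC hmid)) (hne (hC hc))
  refine Eq.trans ?_ (hfin.trans ?_)
  · simp only [map_div₀, map_mul, map_pow, toRatFun_C_X, invVars_zVar]
  · rw [map_mul toRatFun _ P', he_img, hP', map_mul toRatFun _ (denPos w), hc'_img,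
      ← invVars_denMid, ← invVars_denPos]

end SL2Plethysm

theorem mainTheorem2 (w : ℕ) (hw : 1 < w) (μ : YoungDiagram) (hμ : μ.card = w) :
    ∃ R R' : SL2Plethysm.RatFun,
      SL2Plethysm.IsExpansionOf (SL2Plethysm.genFun μ) R ∧
      SL2Plethysm.IsExpansionOf (SL2Plethysm.genFun μ.transpose) R' ∧
      SL2Plethysm.invVars R = (-1) ^ w * SL2Plethysm.zVar ^ 2 * R' := by
  subst hμ
  exact SL2Plethysm.exists_reciprocal_expansions hw
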